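/- Let $\ell\ge 1$ be an integer and $\xi=e^{2i\pi/\ell}$; write $\xi^x=e^{2i\pi x/\ell}$ for $x\in\mathbb C$. Let $\Lambda$ be a free abelian group of rank $r$ with basis $b_1,\dots,b_r$, let $\Lambda^*=\mathrm{Hom}_{\mathbb Z}(\Lambda,\mathbb Z)$ with dual basis $a_1,\dots,a_r$, and let $\mathbb C[\Lambda^*]$ be the group algebra, spanned by the group-like elements $K^a$ ($a\in\Lambda^*$); put $K_i=K^{a_i}$. Let $W$ be a finite dimensional $\Lambda$-graded complex vector space with an element $1_W$ of degree $0$. Let $\mathcal U$ be a $\Lambda$-graded Hopf algebra over $\mathbb C$ with coproduct $\Delta$, counit $\varepsilon$ and antipode $S$, whose underlying graded vector space is $W\otimes\mathbb C[\Lambda^*]$ ($w\otimes p$ being the product of $w=w\otimes 1$ and $p=1_W\otimes p$), which contains $\mathbb C[\Lambda^*]=1_W\otimes\mathbb C[\Lambda^*]$ as a Hopf subalgebra of degree $0$, and in which $K^axK^{-a}=\xi^{a(|x|)}x$ for $a\in\Lambda^*$ and homogeneous $x\in W$ of degree $|x|$. Let $g\in\mathcal U$ be a pivot, i.e. a group-like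 element with $S^2(x)=gxg^{-1}$ for all $x\in\mathcal U$. Let $\mathcal U^H$ be the algebra generated by $\mathcal U$ and elements $H_a$ ($a\in\Lambda^*$), additive in $a$ and commuting with each other, with $H_ax=x(H_a+a(|x|))$ for homogeneous $x\in\mathcal U$; extend $\Delta$ to it by letting the $H_a$ be primitive, and the grading by giving the $H_a$ degree $0$. Let $B:\Lambda\times\Lambda\to\mathbb Z$ be a symmetric bilinear form, $B_\lambda=K^{B(\lambda,\cdot)}$, and let $\widetilde{\mathcal H}(x\otimes y)=xB_{|y|}\otimes B_{|x|}y$ for homogeneous $x,y\in\mathcal U^H$. Let $\check{\mathcal R}=\sum_i x_i\otimes y_i\in\mathcal U\otimes\mathcal U$ ($x_i,y_i$ homogeneous) be an invertible element such that, $\tau$ being the flip, $$\tau(\Delta u)=\widetilde{\mathcal H}\big(\check{\mathcal R}\,(\Delta u)\,\check{\mathcal R}^{-1}\big)\ \text{ for all } u\in\mathcal U^H,$$ $$(\Delta\otimes\mathrm{id})\check{\mathcal R}=\Big(\sum_i x_i\otimes B_{|y_i|}^{-1}\otimes y_i\Big)(1\otimes\check{\mathcal R}),\qquad (\mathrm{id}\otimes\Delta)\check{\mathcal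 R}=\Big(\sum_i x_i\otimes B_{|x_i|}^{-1}\otimes y_i\Big)(\check{\mathcal R}\otimes 1),$$ $$\sum_i y_igx_iB_{|x_i|}=\sum_i x_ig^{-1}y_iB_{|x_i|}^{-1}.$$ Let $G=(\mathbb C/\mathbb Z)^r$. For $\bar\alpha=(\bar\alpha_1,\dots,\bar\alpha_r)\in G$ let $\pi_{\bar\alpha}:\mathcal U\to\mathcal U_{\bar\alpha}$ be the quotient of $\mathcal U$ by the two-sided ideal generated by the elements $K_i^\ell-\xi^{\ell\alpha_i}$, $1\le i\le r$, and let $g_{\bar\alpha}=\pi_{\bar\alpha}(g)$. The Hopf $G$-coalgebra $\mathcal U_\bullet=\{\mathcal U_{\bar\alpha}\}_{\bar\alpha\in G}$ carries the maps $\Delta_{\bar\alpha,\bar\beta}:\mathcal U_{\bar\alpha+\bar\beta}\to\mathcal U_{\bar\alpha}\otimes\mathcal U_{\bar\beta}$ and $\varepsilon:\mathcal U_{\bar 0}\to\mathbb C$ induced by $\Delta$ and $\varepsilon$. Assume that $\mathcal U_{\bar 0}$ is unimodular, i.e. has a nonzero element $\Upsilon$ with $x\Upsilon=\Upsilon x=\varepsilon(x)\Upsilon$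 for all $x\in\mathcal U_{\bar 0}$. Let $\{\lambda^R_{\bar\alpha}\}_{\bar\alpha\in G}$ be the right $G$-integral of $\mathcal U_\bullet$ with $\lambda^R_{\bar 0}(\Upsilon)=1$, i.e. linear forms with $(\lambda^R_{\bar\alpha}\otimes\mathrm{id})\Delta_{\bar\alpha,\bar\beta}(x)=\lambda^R_{\bar\alpha+\bar\beta}(x)\,1$ for all $\bar\alpha,\bar\beta$ and all $x\in\mathcal U_{\bar\alpha+\bar\beta}$. Let $\mathcal H_0\in\mathcal U_{\bar 0}\otimes\mathcal U_{\bar 0}$ be the image of $$\frac1{\ell^{2r}}\sum_{k,k',m,n\in\{0,\dots,\ell-1\}^r}\xi^{-\sum_s k_sm_s-\sum_s k'_sn_s+B(\sum_s m_sb_s,\sum_s n_sb_s)}\,K^{\sum_s k_sa_s}\otimes K^{\sum_s k'_sa_s},$$ and let $\theta_{\bar 0}\in\mathcal U_{\bar 0}$ be the image of $g^{-1}\,m\big((S^2\otimes\mathrm{id})(\mathcal H_0\check{\mathcal R})\big)$, where $m$ is the multiplication. Assume that $\theta_{\bar 0}$ is invertible and $\lambda^R_{\bar 0}(\theta_{\bar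 0})\,\lambda^R_{\bar 0}(\theta_{\bar 0}^{-1})=1$. A $G$-grouplike element of $\mathcal U_\bullet$ is a family $\gamma_{\bar\alpha}\in\mathcal U_{\bar\alpha}$ with $\Delta_{\bar\alpha,\bar\beta}(\gamma_{\bar\alpha+\bar\beta})=\gamma_{\bar\alpha}\otimes\gamma_{\bar\beta}$ for all $\bar\alpha,\bar\beta\in G$ and $\varepsilon(\gamma_{\bar 0})=1$. It is called distinguished if the forms $\lambda^L_{\bar\alpha}(x)=\lambda^R_{\bar\alpha}(\gamma_{\bar\alpha}x)$ constitute a left $G$-integral, i.e. $(\mathrm{id}\otimes\lambda^L_{\bar\beta})\Delta_{\bar\alpha,\bar\beta}(x)=\lambda^L_{\bar\alpha+\bar\beta}(x)\,1$ for all $\bar\alpha,\bar\beta\in G$ and $x\in\mathcal U_{\bar\alpha+\bar\beta}$. Then the distinguished $G$-grouplike element $\gamma_\bullet$ of $\mathcal U_\bullet$ is the square of the pivot: $\{g_{\bar\alpha}^2\}_{\bar\alpha\in G}$ is distinguished, and every distinguished $G$-grouplike element $\gamma_\bullet$ satisfies $\gamma_{\bar\alpha}=g_{\bar\alpha}^2$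 for every $\bar\alpha\in G$. -/

import Mathlib

open scoped TensorProduct

noncomputable section

namespace UnrolledHopf

/-! ### Hopf group-coalgebras: group-like families and integrals -/

section GCoalgebra

variable {G : Type*} [AddCommGroup G] {H : G → Type*} [∀ α, Ring (H α)] [∀ α, Algebra ℂ (H α)]

/-- A family `x_α ∈ H_α` is `G`-grouplike if `Δ_{α,β}(x_{α+β}) = x_α ⊗ x_β` and `ε(x_0) = 1`. -/
structure IsGGrouplike (Δ : ∀ α β, H (α + β) →ₐ[ℂ] H α ⊗[ℂ] H β) (ε : H 0 →ₐ[ℂ] ℂ)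
    (x : ∀ α, H α) : Prop where
  comul_eq : ∀ α β, Δ α β (x (α + β)) = x α ⊗ₜ[ℂ] x β
  counit_eq : ε (x 0) = 1

/-- A family of linear forms `f_α` is a right `G`-integral if
`(f_α ⊗ id) Δ_{α,β}(x) = f_{α+β}(x) 1_β`. -/
def IsRightGIntegral (Δ : ∀ α β, H (α + β) →ₐ[ℂ] H α ⊗[ℂ] H β)
    (f : ∀ α, H α →ₗ[ℂ] ℂ) : Prop :=
  ∀ α β (x : H (α + β)),
    TensorProduct.lid ℂ (H β) ((f α).rTensor (H β) (Δ α β x)) = f (α + β) x • (1 : H β)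

/-- A family of linear forms `f_α` is a left `G`-integral if
`(id ⊗ f_β) Δ_{α,β}(x) = f_{α+β}(x) 1_α`. -/
def IsLeftGIntegral (Δ : ∀ α β, H (α + β) →ₐ[ℂ] H α ⊗[ℂ] H β)
    (f : ∀ α, H α →ₗ[ℂ] ℂ) : Prop :=
  ∀ α β (x : H (α + β)),
    TensorProduct.rid ℂ (H α) ((f β).lTensor (H α) (Δ α β x)) = f (α + β) x • (1 : H α)

/-- `γ` is a distinguished `G`-grouplike element, relative to the right `G`-integral `lam`:
it is `G`-grouplike and the family of forms `x ↦ lam_α(γ_α x)` is a left `G`-integral. -/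
structure IsDistinguished (Δ : ∀ α β, H (α + β) →ₐ[ℂ] H α ⊗[ℂ] H β) (ε : H 0 →ₐ[ℂ] ℂ)
    (lam : ∀ α, H α →ₗ[ℂ] ℂ) (γ : ∀ α, H α) : Prop where
  grouplike : IsGGrouplike Δ ε γ
  left_integral : IsLeftGIntegral Δ fun α => lam α ∘ₗ LinearMap.mulLeft ℂ (γ α)

end GCoalgebra

/-- `Υ` is a two-sided cointegral of an algebra with augmentation `ε`. -/
structure IsTwoSidedCointegral {A : Type*} [Ring A] [Algebra ℂ A] (ε : A →ₐ[ℂ] ℂ) (Υ : A) :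
    Prop where
  ne_zero : Υ ≠ 0
  left : ∀ x, x * Υ = ε x • Υ
  right : ∀ x, Υ * x = ε x • Υ

/-! ### The Hopf algebra `𝒰` -/

/-- The root of unity `ξ = exp(2πi/ℓ)`. -/
def xi (ℓ : ℕ) : ℂ := Complex.exp (2 * Real.pi * Complex.I / ℓ)

/-- The group algebra `ℂ[Λ*]`, `Λ* = Hom(Λ, ℤ)`. -/
abbrev DualGroupAlgebra (Λ : Type*) [AddCommGroup Λ] : Type _ :=
  AddMonoidAlgebra ℂ (Module.Dual ℤ Λ)

/-- For linear maps `φ_l`, the linear map sending `x` to `∑_l φ_l(x_l)`, where `x_l` is the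
component of degree `l` of `x`. -/
def byDegree {Λ : Type*} [DecidableEq Λ] {U : Type*} [Ring U] [Algebra ℂ U]
    (𝒰 : Λ → Submodule ℂ U) [DirectSum.Decomposition 𝒰]
    {M : Type*} [AddCommGroup M] [Module ℂ M] (φ : Λ → U →ₗ[ℂ] M) : U →ₗ[ℂ] M :=
  DirectSum.toModule ℂ Λ M (fun l => φ l ∘ₗ (𝒰 l).subtype) ∘ₗ
    (DirectSum.decomposeLinearEquiv 𝒰).toLinearMap

theorem byDegree_of_mem {Λ : Type*} [DecidableEq Λ] {U : Type*} [Ring U] [Algebra ℂ U]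
    (𝒰 : Λ → Submodule ℂ U) [DirectSum.Decomposition 𝒰]
    {M : Type*} [AddCommGroup M] [Module ℂ M] (φ : Λ → U →ₗ[ℂ] M) {l : Λ} {x : U}
    (hx : x ∈ 𝒰 l) : byDegree 𝒰 φ x = φ l x := by
  have h := DirectSum.decomposeLinearEquiv_apply_coe (R := ℂ) 𝒰 l ⟨x, hx⟩
  simp only [byDegree, LinearMap.comp_apply, LinearEquiv.coe_coe]
  rw [h, DirectSum.toModule_lof]
  rfl

section Algebra

variable {Λ : Type*} [AddCommGroup Λ]
variable {U : Type*} [Ring U] [HopfAlgebra ℂ U]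

/-- The image `K^a ∈ 𝒰` of the generator of `ℂ[Λ*]` indexed by `a ∈ Λ*`. -/
def Kel (K : DualGroupAlgebra Λ →ₐc[ℂ] U) (a : Module.Dual ℤ Λ) : U :=
  K (AddMonoidAlgebra.single a 1)



/-- `𝒰` is a `Λ`-graded Hopf algebra (the algebra being graded by the instance `GradedAlgebra`):
the comultiplication, counit and antipode preserve the degree. -/
structure IsGradedHopf (𝒰 : Λ → Submodule ℂ U) : Prop where
  comul_mem : ∀ (l : Λ), ∀ x ∈ 𝒰 l, Coalgebra.comul (R := ℂ) x ∈
    Submodule.span ℂ {t : U ⊗[ℂ] U |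
      ∃ m n : Λ, m + n = l ∧ ∃ y ∈ 𝒰 m, ∃ z ∈ 𝒰 n, t = y ⊗ₜ[ℂ] z}
  counit_eq_zero : ∀ (l : Λ), l ≠ 0 → ∀ x ∈ 𝒰 l, Coalgebra.counit (R := ℂ) x = 0
  antipode_mem : ∀ (l : Λ), ∀ x ∈ 𝒰 l, HopfAlgebra.antipode ℂ x ∈ 𝒰 l

/-- A pivot of a Hopf algebra: a group-like `g` with `S²(x) = g x g⁻¹`. -/
structure IsPivot (g : Uˣ) : Prop where
  grouplike : IsGroupLikeElem ℂ (g : U)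
  antipode_sq : ∀ x : U, HopfAlgebra.antipode ℂ (HopfAlgebra.antipode ℂ x) = g * x * (g⁻¹ : Uˣ)

/-- `U` is a `Λ`-graded pivotal Hopf algebra with underlying graded vector space `W ⊗ ℂ[Λ*]`
(where `w ⊗ p` corresponds to the product `j(w) K(p)`), which extends the Hopf algebra
`ℂ[Λ*] = 1_W ⊗ ℂ[Λ*]`, and in which `K^a w K^{-a} = ξ^{a(|w|)} w` for homogeneous `w ∈ W`. -/
structure IsPivotalExtension (ℓ : ℕ) {W : Type*} [AddCommGroup W] [Module ℂ W]
    (𝒲 : Λ → Submodule ℂ W) (oneW : W) (𝒰 : Λ → Submodule ℂ U)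
    (j : W →ₗ[ℂ] U) (K : DualGroupAlgebra Λ →ₐc[ℂ] U) (g : Uˣ) : Prop where
  graded : IsGradedHopf 𝒰
  pivot : IsPivot g
  oneW_mem : oneW ∈ 𝒲 0
  map_oneW : j oneW = 1
  bijective : Function.Bijective
    (TensorProduct.lift ((LinearMap.mul ℂ U).compl₁₂ j (K : DualGroupAlgebra Λ →ₗ[ℂ] U)))
  mul_mem : ∀ (l : Λ), ∀ w ∈ 𝒲 l, ∀ p : DualGroupAlgebra Λ, j w * K p ∈ 𝒰 l
  conj : ∀ (a : Module.Dual ℤ Λ) (l : Λ), ∀ w ∈ 𝒲 l,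
    Kel K a * j w * Kel K (-a) = xi ℓ ^ (a l) • j w

/-! ### The unrolled Hopf algebra `𝒰^H = 𝒰 ⋊ S𝔥` -/

/-- The relations of `𝒰^H`: those of `𝒰`, those of the symmetric algebra of `Λ* ⊗ ℂ` (on
generators `H_a`, `a ∈ Λ*`), and `H_a x = x (H_a + a(|x|))` for homogeneous `x ∈ 𝒰`. -/
inductive UHRel (𝒰 : Λ → Submodule ℂ U) :
    FreeAlgebra ℂ (U ⊕ Module.Dual ℤ Λ) → FreeAlgebra ℂ (U ⊕ Module.Dual ℤ Λ) → Prop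
  | add (x y : U) : UHRel 𝒰 (FreeAlgebra.ι ℂ (.inl (x + y)))
      (FreeAlgebra.ι ℂ (.inl x) + FreeAlgebra.ι ℂ (.inl y))
  | mul (x y : U) : UHRel 𝒰 (FreeAlgebra.ι ℂ (.inl (x * y)))
      (FreeAlgebra.ι ℂ (.inl x) * FreeAlgebra.ι ℂ (.inl y))
  | scalar (c : ℂ) : UHRel 𝒰 (FreeAlgebra.ι ℂ (.inl (algebraMap ℂ U c))) (algebraMap ℂ _ c)
  | cartan_add (a b : Module.Dual ℤ Λ) : UHRel 𝒰 (FreeAlgebra.ι ℂ (.inr (a + b)))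
      (FreeAlgebra.ι ℂ (.inr a) + FreeAlgebra.ι ℂ (.inr b))
  | cartan_comm (a b : Module.Dual ℤ Λ) :
      UHRel 𝒰 (FreeAlgebra.ι ℂ (.inr a) * FreeAlgebra.ι ℂ (.inr b))
        (FreeAlgebra.ι ℂ (.inr b) * FreeAlgebra.ι ℂ (.inr a))
  | weight (a : Module.Dual ℤ Λ) (l : Λ) (x : U) (hx : x ∈ 𝒰 l) :
      UHRel 𝒰 (FreeAlgebra.ι ℂ (.inr a) * FreeAlgebra.ι ℂ (.inl x))
        (FreeAlgebra.ι ℂ (.inl x) * (FreeAlgebra.ι ℂ (.inr a) + algebraMap ℂ _ ((a l : ℤ) : ℂ)))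

/-- The unrolled algebra `𝒰^H = 𝒰 ⋊ S𝔥`. -/
def UH (𝒰 : Λ → Submodule ℂ U) : Type _ := RingQuot (UHRel 𝒰)

namespace UH

variable (𝒰 : Λ → Submodule ℂ U)

instance : Ring (UH 𝒰) := inferInstanceAs (Ring (RingQuot (UHRel 𝒰)))

instance : Algebra ℂ (UH 𝒰) := inferInstanceAs (Algebra ℂ (RingQuot (UHRel 𝒰)))

/-- The quotient map from the free algebra. -/
def mk : FreeAlgebra ℂ (U ⊕ Module.Dual ℤ Λ) →ₐ[ℂ] UH 𝒰 := RingQuot.mkAlgHom ℂ (UHRel 𝒰)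

variable {𝒰} in
theorem mk_rel {x y : FreeAlgebra ℂ (U ⊕ Module.Dual ℤ Λ)} (h : UHRel 𝒰 x y) :
    mk 𝒰 x = mk 𝒰 y := RingQuot.mkAlgHom_rel ℂ h

/-- The inclusion `𝒰 → 𝒰^H`. -/
def incl : U →ₐ[ℂ] UH 𝒰 where
  toFun x := mk 𝒰 (FreeAlgebra.ι ℂ (.inl x))
  map_one' := by
    have h := mk_rel (UHRel.scalar (𝒰 := 𝒰) 1)
    simpa using h
  map_mul' x y := by
    have h := mk_rel (UHRel.mul (𝒰 := 𝒰) x y)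
    simpa using h
  map_zero' := by
    have h := mk_rel (UHRel.scalar (𝒰 := 𝒰) 0)
    simpa using h
  map_add' x y := by
    have h := mk_rel (UHRel.add (𝒰 := 𝒰) x y)
    simpa using h
  commutes' c := by
    have h := mk_rel (UHRel.scalar (𝒰 := 𝒰) c)
    simpa using h

/-- The generators `H_a`, `a ∈ Λ*`. -/
def cartan (a : Module.Dual ℤ Λ) : UH 𝒰 := mk 𝒰 (FreeAlgebra.ι ℂ (.inr a))

theorem cartan_add (a b : Module.Dual ℤ Λ) : cartan 𝒰 (a + b) = cartan 𝒰 a + cartan 𝒰 b := by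
  simpa [cartan] using mk_rel (UHRel.cartan_add (𝒰 := 𝒰) a b)

theorem cartan_comm (a b : Module.Dual ℤ Λ) :
    cartan 𝒰 a * cartan 𝒰 b = cartan 𝒰 b * cartan 𝒰 a := by
  simpa [cartan] using mk_rel (UHRel.cartan_comm (𝒰 := 𝒰) a b)

variable {𝒰} in
theorem cartan_mul_incl (a : Module.Dual ℤ Λ) {l : Λ} {x : U} (hx : x ∈ 𝒰 l) :
    cartan 𝒰 a * incl 𝒰 x = incl 𝒰 x * (cartan 𝒰 a + algebraMap ℂ _ ((a l : ℤ) : ℂ)) := by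
  have h := mk_rel (UHRel.weight (𝒰 := 𝒰) a l x hx)
  rw [map_mul, map_mul, map_add, AlgHom.commutes] at h
  exact h

/-- The universal property of `𝒰^H`. -/
def lift {A : Type*} [Ring A] [Algebra ℂ A] (f : U →ₐ[ℂ] A) (h : Module.Dual ℤ Λ → A)
    (hadd : ∀ a b, h (a + b) = h a + h b) (hcomm : ∀ a b, h a * h b = h b * h a)
    (hwt : ∀ (a : Module.Dual ℤ Λ) (l : Λ), ∀ x ∈ 𝒰 l,
      h a * f x = f x * (h a + algebraMap ℂ A ((a l : ℤ) : ℂ))) :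
    UH 𝒰 →ₐ[ℂ] A :=
  RingQuot.liftAlgHom ℂ ⟨FreeAlgebra.lift ℂ (Sum.elim f h), by
    intro x y hxy
    cases hxy with
    | add x y => simp
    | mul x y => simp
    | scalar c => simp
    | cartan_add a b => simp [hadd]
    | cartan_comm a b => simp [hcomm a b]
    | weight a l x hx =>
      simp only [map_mul, map_add, FreeAlgebra.lift_ι_apply, Sum.elim_inl, Sum.elim_inr,
        AlgHom.commutes]
      exact hwt a l x hx⟩

/-- The comultiplication of `𝒰^H`: it extends that of `𝒰`, and the `H_a` are primitive. -/
def comul (h𝒰 : IsGradedHopf 𝒰) : UH 𝒰 →ₐ[ℂ] UH 𝒰 ⊗[ℂ] UH 𝒰 :=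
  lift 𝒰 ((Algebra.TensorProduct.map (incl 𝒰) (incl 𝒰)).comp (Bialgebra.comulAlgHom ℂ U))
    (fun a => cartan 𝒰 a ⊗ₜ[ℂ] 1 + 1 ⊗ₜ[ℂ] cartan 𝒰 a)
    (fun a b => by
      simp only [cartan_add, TensorProduct.add_tmul, TensorProduct.tmul_add]
      abel)
    (fun a b => by
      simp only [mul_add, add_mul, Algebra.TensorProduct.tmul_mul_tmul, one_mul, mul_one,
        cartan_comm 𝒰 a b]
      abel)
    (fun a l x hx => by
      have key : ∀ t ∈ Submodule.span ℂ {t : U ⊗[ℂ] U |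
          ∃ m n : Λ, m + n = l ∧ ∃ y ∈ 𝒰 m, ∃ z ∈ 𝒰 n, t = y ⊗ₜ[ℂ] z},
          (cartan 𝒰 a ⊗ₜ[ℂ] 1 + 1 ⊗ₜ[ℂ] cartan 𝒰 a) *
            Algebra.TensorProduct.map (incl 𝒰) (incl 𝒰) t =
          Algebra.TensorProduct.map (incl 𝒰) (incl 𝒰) t *
            ((cartan 𝒰 a ⊗ₜ[ℂ] 1 + 1 ⊗ₜ[ℂ] cartan 𝒰 a) +
              algebraMap ℂ _ ((a l : ℤ) : ℂ)) := by
        intro t ht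
        induction ht using Submodule.span_induction with
        | mem t ht =>
          obtain ⟨m, n, rfl, y, hy, z, hz, rfl⟩ := ht
          simp only [Algebra.TensorProduct.map_tmul, add_mul, mul_add,
            Algebra.TensorProduct.tmul_mul_tmul, one_mul, mul_one, cartan_mul_incl a hy,
            cartan_mul_incl a hz, TensorProduct.add_tmul, TensorProduct.tmul_add,
            Algebra.algebraMap_eq_smul_one, mul_smul_comm, map_add, Int.cast_add,
            TensorProduct.tmul_smul, TensorProduct.smul_tmul']
          abel
        | zero => simp
        | add s t _ _ hs ht => rw [map_add, mul_add, hs, ht, add_mul]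
        | smul c t _ ht => rw [map_smul, mul_smul_comm, ht, smul_mul_assoc]
      exact key _ (h𝒰.comul_mem l x hx))

/-- The linear map `x ↦ x T^l` from `𝒰^H` to its group ring over `Λ`. -/
def single (l : Λ) : UH 𝒰 →ₗ[ℂ] AddMonoidAlgebra (UH 𝒰) Λ where
  toFun x := AddMonoidAlgebra.single l x
  map_add' x y := by simp
  map_smul' c x := by simp

/-- The `Λ`-grading of `𝒰^H`, in which `𝒰` keeps its grading and the `H_a` have degree `0`:
the algebra morphism `x ↦ ∑_l x_l T^l`. -/
def grading [DecidableEq Λ] [GradedAlgebra 𝒰] : UH 𝒰 →ₐ[ℂ] AddMonoidAlgebra (UH 𝒰) Λ :=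
  lift 𝒰
    (AlgHom.ofLinearMap (byDegree 𝒰 fun l => single 𝒰 l ∘ₗ (incl 𝒰).toLinearMap)
      (by
        rw [byDegree_of_mem 𝒰 _ (SetLike.GradedOne.one_mem (A := 𝒰))]
        simp [single, AddMonoidAlgebra.one_def])
      (fun x y => by
        induction x using DirectSum.Decomposition.inductionOn 𝒰 with
        | zero => simp
        | add x x' hx hx' => rw [add_mul, map_add, hx, hx', map_add, add_mul]
        | @homogeneous l x =>
          induction y using DirectSum.Decomposition.inductionOn 𝒰 with
          | zero => simp
          | add y y' hy hy' => rw [mul_add, map_add, hy, hy', map_add, mul_add]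
          | @homogeneous m y =>
            rw [byDegree_of_mem 𝒰 _ x.2, byDegree_of_mem 𝒰 _ y.2,
              byDegree_of_mem 𝒰 _ (SetLike.GradedMul.mul_mem x.2 y.2)]
            simp [single, AddMonoidAlgebra.single_mul_single]))
    (fun a => AddMonoidAlgebra.single 0 (cartan 𝒰 a))
    (fun a b => by simp [cartan_add])
    (fun a b => by simp [AddMonoidAlgebra.single_mul_single, cartan_comm 𝒰 a b])
    (fun a l x hx => by
      have h0 : algebraMap ℂ (AddMonoidAlgebra (UH 𝒰) Λ) ((a l : ℤ) : ℂ) =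
          AddMonoidAlgebra.single 0 (algebraMap ℂ (UH 𝒰) ((a l : ℤ) : ℂ)) := rfl
      rw [AlgHom.ofLinearMap_apply, byDegree_of_mem 𝒰 _ hx, h0, ← AddMonoidAlgebra.single_add]
      simp only [single, LinearMap.comp_apply, LinearMap.coe_mk, AddHom.coe_mk,
        AlgHom.toLinearMap_apply, AddMonoidAlgebra.single_mul_single, zero_add, add_zero,
        cartan_mul_incl a hx])

/-- The linear map taking `x ∈ 𝒰^H` to the family of its homogeneous components. -/
def components [DecidableEq Λ] [GradedAlgebra 𝒰] : UH 𝒰 →ₗ[ℂ] Λ →₀ UH 𝒰 where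
  toFun x := (grading 𝒰 x).coeff
  map_add' x y := by simp
  map_smul' c x := by simp

/-- The map `ℋ̃(x ⊗ y) = x B_{|y|} ⊗ B_{|x|} y` (`x`, `y` homogeneous) on `𝒰^H ⊗ 𝒰^H`, where
`B_l = K^{B(l, ·)}`. -/
def twist [DecidableEq Λ] [GradedAlgebra 𝒰] (K : DualGroupAlgebra Λ →ₐc[ℂ] U)
    (B : Λ →ₗ[ℤ] Λ →ₗ[ℤ] ℤ) : UH 𝒰 ⊗[ℂ] UH 𝒰 →ₗ[ℂ] UH 𝒰 ⊗[ℂ] UH 𝒰 :=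
  TensorProduct.lift
    ((Finsupp.lsum ℂ fun l => (Finsupp.lsum ℂ fun m =>
      ((TensorProduct.mk ℂ (UH 𝒰) (UH 𝒰)).compl₁₂
        (LinearMap.mulRight ℂ (incl 𝒰 (Kel K (B m))))
        (LinearMap.mulLeft ℂ (incl 𝒰 (Kel K (B l))))).flip).flip).compl₁₂
      (components 𝒰) (components 𝒰))

end UH

/-! ### Quasi R-matrices -/

/-- `Rc ∈ 𝒰 ⊗ 𝒰`, invertible, is a quasi R-matrix for the symmetric integral form `B`:
(R1) `τ(Δu) = ℋ̃(Rc Δ(u) Rc⁻¹)` for all `u ∈ 𝒰^H`;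
(R2) `Δ₁ Rc = (∑ x_i ⊗ B_{|y_i|}⁻¹ ⊗ y_i) Rc₂₃`;
(R3) `Δ₂ Rc = (∑ x_i ⊗ B_{|x_i|}⁻¹ ⊗ y_i) Rc₁₂`;
(R4) `∑ y_i g x_i B_{|x_i|} = ∑ x_i g⁻¹ y_i B_{|x_i|}⁻¹`;
where `Rc = ∑ x_i ⊗ y_i` with `x_i`, `y_i` homogeneous. -/
structure IsQuasiRMatrix [DecidableEq Λ] (𝒰 : Λ → Submodule ℂ U) [GradedAlgebra 𝒰]
    (h𝒰 : IsGradedHopf 𝒰) (K : DualGroupAlgebra Λ →ₐc[ℂ] U) (g : Uˣ)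
    (B : Λ →ₗ[ℤ] Λ →ₗ[ℤ] ℤ) (Rc : (U ⊗[ℂ] U)ˣ) : Prop where
  R1 : ∀ u : UH 𝒰,
    TensorProduct.comm ℂ (UH 𝒰) (UH 𝒰) (UH.comul 𝒰 h𝒰 u) =
      UH.twist 𝒰 K B
        (Algebra.TensorProduct.map (UH.incl 𝒰) (UH.incl 𝒰) (Rc : U ⊗[ℂ] U) *
          UH.comul 𝒰 h𝒰 u *
          Algebra.TensorProduct.map (UH.incl 𝒰) (UH.incl 𝒰) ((Rc⁻¹ : (U ⊗[ℂ] U)ˣ) : U ⊗[ℂ] U))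
  R2 : TensorProduct.assoc ℂ U U U ((Coalgebra.comul (R := ℂ)).rTensor U (Rc : U ⊗[ℂ] U)) =
    (byDegree 𝒰 fun l => TensorProduct.mk ℂ U U (Kel K (B (-l)))).lTensor U (Rc : U ⊗[ℂ] U) *
      (1 : U) ⊗ₜ[ℂ] (Rc : U ⊗[ℂ] U)
  R3 : (Coalgebra.comul (R := ℂ)).lTensor U (Rc : U ⊗[ℂ] U) =
    TensorProduct.assoc ℂ U U U
      ((byDegree 𝒰 fun l => (TensorProduct.mk ℂ U U).flip (Kel K (B (-l)))).rTensor U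
          (Rc : U ⊗[ℂ] U)) *
      TensorProduct.assoc ℂ U U U ((Rc : U ⊗[ℂ] U) ⊗ₜ[ℂ] (1 : U))
  R4 : TensorProduct.lift
      (byDegree 𝒰 fun l => (LinearMap.mul ℂ U).flip.compl₁₂
        (LinearMap.mulLeft ℂ (g : U) ∘ₗ LinearMap.mulRight ℂ (Kel K (B l))) LinearMap.id)
      (Rc : U ⊗[ℂ] U) =
    TensorProduct.lift
      (byDegree 𝒰 fun l => (LinearMap.mul ℂ U).compl₁₂
        (LinearMap.mulRight ℂ ((g⁻¹ : Uˣ) : U)) (LinearMap.mulRight ℂ (Kel K (B (-l)))))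
      (Rc : U ⊗[ℂ] U)

/-! ### The Hopf `G`-coalgebra `𝒰_•`, `G = (ℂ/ℤ)^r` -/

/-- The group `G = 𝔥*/Λ = (ℂ/ℤ)^r`, in the coordinates given by a basis of `Λ`. -/
abbrev GroupG (r : ℕ) : Type := Fin r → ℂ ⧸ AddSubgroup.zmultiples (1 : ℂ)

/-- The generators `K_i^ℓ - ξ^{ℓ α_i}` of the ideal `I_α`; here `K_i = K^{a_i}`, where `a_i` is the
basis of `Λ*` dual to `b`, and `z` runs over the representatives of `α_i ∈ ℂ/ℤ`. -/
inductive GRel (ℓ : ℕ) {r : ℕ} (b : Module.Basis (Fin r) ℤ Λ) (K : DualGroupAlgebra Λ →ₐc[ℂ] U)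
    (α : GroupG r) : U → U → Prop
  | rel (i : Fin r) (z : ℂ) (hz : (z : ℂ ⧸ AddSubgroup.zmultiples (1 : ℂ)) = α i) :
      GRel ℓ b K α (Kel K (b.coord i) ^ ℓ)
        (algebraMap ℂ U (Complex.exp (2 * Real.pi * Complex.I / ℓ * (ℓ * z))))

/-- The algebra `𝒰_α = 𝒰 / I_α`. -/
abbrev Ubar (ℓ : ℕ) {r : ℕ} (b : Module.Basis (Fin r) ℤ Λ) (K : DualGroupAlgebra Λ →ₐc[ℂ] U)
    (α : GroupG r) : Type _ := RingQuot (GRel ℓ b K α)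

namespace Ubar

variable (ℓ : ℕ) {r : ℕ} (b : Module.Basis (Fin r) ℤ Λ)
  (K : DualGroupAlgebra Λ →ₐc[ℂ] U)

/-- The projection `π_α : 𝒰 → 𝒰_α`. -/
def proj (α : GroupG r) : U →ₐ[ℂ] Ubar ℓ b K α :=
  RingQuot.mkAlgHom ℂ (GRel ℓ b K α)

theorem comul_Kel (a : Module.Dual ℤ Λ) :
    Bialgebra.comulAlgHom ℂ U (Kel K a) = Kel K a ⊗ₜ[ℂ] Kel K a := by
  simp [Kel, ← CoalgHomClass.map_comp_comul_apply]

theorem counit_Kel (a : Module.Dual ℤ Λ) : Bialgebra.counitAlgHom ℂ U (Kel K a) = 1 := by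
  simp [Kel]

theorem proj_Kel_pow (α : GroupG r) (i : Fin r) (z : ℂ)
    (hz : (z : ℂ ⧸ AddSubgroup.zmultiples (1 : ℂ)) = α i) :
    proj ℓ b K α (Kel K (b.coord i)) ^ ℓ =
      algebraMap ℂ _ (Complex.exp (2 * Real.pi * Complex.I / ℓ * (ℓ * z))) := by
  have h := RingQuot.mkAlgHom_rel ℂ (GRel.rel (ℓ := ℓ) (b := b) (K := K) (α := α) i z hz)
  rw [map_pow, AlgHom.commutes] at h
  exact h

theorem exp_eq [NeZero ℓ] {z w : ℂ} (h : (z : ℂ ⧸ AddSubgroup.zmultiples (1 : ℂ)) = w) :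
    Complex.exp (2 * Real.pi * Complex.I / ℓ * (ℓ * z)) =
      Complex.exp (2 * Real.pi * Complex.I / ℓ * (ℓ * w)) := by
  have hl : (ℓ : ℂ) ≠ 0 := Nat.cast_ne_zero.mpr (NeZero.ne ℓ)
  rw [QuotientAddGroup.eq, AddSubgroup.mem_zmultiples_iff] at h
  obtain ⟨n, hn⟩ := h
  rw [Complex.exp_eq_exp_iff_exists_int]
  refine ⟨-n, ?_⟩
  have hw : w = z + n := by
    have : (n : ℂ) = -z + w := by simpa using hn
    rw [this]; ring
  rw [hw]
  field_simp
  push_cast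
  ring

/-- The comultiplication `Δ_{α,β} : 𝒰_{α+β} → 𝒰_α ⊗ 𝒰_β` induced by that of `𝒰`. -/
def comul [NeZero ℓ] (α β : GroupG r) : Ubar ℓ b K (α + β) →ₐ[ℂ] Ubar ℓ b K α ⊗[ℂ] Ubar ℓ b K β :=
  RingQuot.liftAlgHom ℂ
    ⟨(Algebra.TensorProduct.map (proj ℓ b K α) (proj ℓ b K β)).comp (Bialgebra.comulAlgHom ℂ U), by
      rintro _ _ ⟨i, z, hz⟩
      obtain ⟨u, hu⟩ := QuotientAddGroup.mk_surjective (α i)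
      obtain ⟨v, hv⟩ := QuotientAddGroup.mk_surjective (β i)
      have hzuv : (z : ℂ ⧸ AddSubgroup.zmultiples (1 : ℂ)) = ((u + v : ℂ) : _) := by
        rw [hz, QuotientAddGroup.mk_add, Pi.add_apply]
        exact congrArg₂ (· + ·) hu.symm hv.symm
      rw [AlgHom.commutes, map_pow, AlgHom.comp_apply, comul_Kel,
        Algebra.TensorProduct.map_tmul, Algebra.TensorProduct.tmul_pow,
        proj_Kel_pow ℓ b K α i u hu, proj_Kel_pow ℓ b K β i v hv, exp_eq ℓ hzuv,
        mul_add, mul_add, Complex.exp_add]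
      simp only [Algebra.algebraMap_eq_smul_one, TensorProduct.smul_tmul', TensorProduct.tmul_smul,
        smul_smul, Algebra.TensorProduct.one_def]
      rw [mul_comm]⟩

/-- The counit `ε : 𝒰_0 → ℂ` induced by that of `𝒰`. -/
def counit [NeZero ℓ] : Ubar ℓ b K (0 : GroupG r) →ₐ[ℂ] ℂ :=
  RingQuot.liftAlgHom ℂ
    ⟨Bialgebra.counitAlgHom ℂ U, by
      rintro _ _ ⟨i, z, hz⟩
      have h0 : (z : ℂ ⧸ AddSubgroup.zmultiples (1 : ℂ)) = ((0 : ℂ) : _) := by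
        rw [hz]; rfl
      rw [AlgHom.commutes, map_pow, counit_Kel, exp_eq ℓ h0]
      simp⟩

end Ubar

/-! ### The twist of `𝒰_0` -/

/-- The element `∑_i k_i b_i` of `Λ`. -/
def latticePoint {ℓ r : ℕ} (b : Module.Basis (Fin r) ℤ Λ) (k : Fin r → Fin ℓ) : Λ :=
  ∑ i, ((k i : ℕ) : ℤ) • b i

/-- The element `∑_i k_i a_i` of `Λ*`, where `a_i` is the basis of `Λ*` dual to `b`. -/
def dualPoint {ℓ r : ℕ} (b : Module.Basis (Fin r) ℤ Λ) (k : Fin r → Fin ℓ) : Module.Dual ℤ Λ :=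
  ∑ i, ((k i : ℕ) : ℤ) • b.coord i

/-- The discrete Fourier transform of `ξ^{B(h₁,h₂)}` on the lattice `Λ × Λ`:
`∑_{k,k'} c_{k,k'} K^k ⊗ K^{k'}` with
`c_{k,k'} = ℓ^{-2r} ∑_{m,n} ξ^{-k(m) - k'(n) + B(m,n)}`, the sums being over `{0,…,ℓ-1}^r`.
Its image in `𝒰_0 ⊗ 𝒰_0` is `ℋ_0`. -/
def fourierH (ℓ : ℕ) {r : ℕ} (b : Module.Basis (Fin r) ℤ Λ) (K : DualGroupAlgebra Λ →ₐc[ℂ] U)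
    (B : Λ →ₗ[ℤ] Λ →ₗ[ℤ] ℤ) : U ⊗[ℂ] U :=
  ∑ k : Fin r → Fin ℓ, ∑ k' : Fin r → Fin ℓ,
    (((ℓ : ℂ) ^ (2 * r))⁻¹ * ∑ m : Fin r → Fin ℓ, ∑ n : Fin r → Fin ℓ,
      xi ℓ ^ (-(dualPoint b k (latticePoint b m)) - dualPoint b k' (latticePoint b n) +
        B (latticePoint b m) (latticePoint b n))) •
      (Kel K (dualPoint b k) ⊗ₜ[ℂ] Kel K (dualPoint b k'))

/-- The twist `θ_0 = g⁻¹ m((S² ⊗ id)(ℋ_0 Rc)) ∈ 𝒰_0`, as the image in `𝒰_0` of the same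
expression in `𝒰`. -/
def theta0 (ℓ : ℕ) {r : ℕ} (b : Module.Basis (Fin r) ℤ Λ) (K : DualGroupAlgebra Λ →ₐc[ℂ] U)
    (g : Uˣ) (B : Λ →ₗ[ℤ] Λ →ₗ[ℤ] ℤ) (Rc : U ⊗[ℂ] U) : Ubar ℓ b K (0 : GroupG r) :=
  Ubar.proj ℓ b K 0 (((g⁻¹ : Uˣ) : U) * LinearMap.mul' ℂ U
    ((HopfAlgebra.antipode ℂ ∘ₗ HopfAlgebra.antipode ℂ).rTensor U (fourierH ℓ b K B * Rc)))

end Algebra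
end UnrolledHopf
end

open UnrolledHopf

/-! Write R for the quasi R-matrix, S⁻¹(x) = g⁻¹ S(x) g, and Δx = x₁ ⊗ x₂. Both claims follow from
one identity, `slice_comm_comul_eq_pivot_sq`: x₁ λ_β(x₂) = λ_{α+β}(x) g_α². For a grouplike family
γ, the identity at γx reads γ_α · x₁ λ_β(γ_β x₂) = λ_{α+β}(γ_{α+β} x) g_α². If γ = g², the
invertible factor g_α² cancels and the forms λ(g² ·) are a left integral. If γ is distinguished,
taking β = -α and x = Υ leaves γ_α = g_α², because λ_0(γ_0 Υ) = ε(γ_0) = 1.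

For the identity, `slice_comm_comul` first shows that y₁ λ_β(y₂) is λ_{α+β}(y) times the fixed
element Υ₁ λ_{-α}(Υ₂). This is uniqueness of the right integral, which holds because p ↦ p(Υ₁)Υ₂ is
a bijection from the dual of 𝒰_α to 𝒰_{-α}. The first R-matrix relation then replaces the opposite
coproduct of Υ by the Cartan twist of R Δ(Υ) R⁻¹. The twist is invisible to λ, since λ vanishes
outside degree 0 and Υ can be replaced by its degree 0 part. Here the condition on θ_0 enters: θ_0
lifts to degree 0 and has nonzero integral, which forces λ_0 to equal its own degree 0 part. Finally
`slice_mul_comul_mul` evaluates the contraction of R Δ(Υ) R⁻¹ as Ψ(R) Φ(R⁻¹), where Ψ(x ⊗ y) = y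
S⁻¹(x) is `mulAntipodeInv` and Φ(x ⊗ y) = S(x) y is `antipodeMul`.

What remains is a computation in 𝒰, `IsQuasiRMatrix.mulAntipodeInv_mul_antipodeMul_inv`: Ψ(R) Φ(R⁻¹)
= g². The Drinfeld-type element P = Ψ(R) intertwines S⁻² with x ↦ B_{|x|} x B_{|x|}, the second
relation gives R⁻¹ explicitly, and the fourth brings in the pivot.

Integrals and cointegrals are pulled back to 𝒰, so that α + β = 0 never requires a transport between
𝒰_{α+β} and 𝒰_0. -/

noncomputable section

namespace UnrolledHopf

open Coalgebra HopfAlgebra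

/-! ### Pivotal Hopf algebras -/

section Pivotal

variable {U : Type*} [Ring U] [HopfAlgebra ℂ U]

/-- The map `x ↦ g⁻¹ S(x) g`, which is the inverse of the antipode if `g` is a pivot. -/
def antipodeInv (g : Uˣ) : U →ₗ[ℂ] U :=
  LinearMap.mulLeft ℂ ((g⁻¹ : Uˣ) : U) ∘ₗ LinearMap.mulRight ℂ (g : U) ∘ₗ antipode ℂ

theorem antipodeInv_apply (g : Uˣ) (x : U) :
    antipodeInv g x = (g⁻¹ : Uˣ) * (antipode ℂ x * g) := rfl

variable {g : Uˣ} (hg : IsPivot g)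

include hg in
theorem IsPivot.antipode_coe : antipode ℂ (g : U) = (g⁻¹ : Uˣ) := by
  have h := hg.grouplike.antipode_mul_cancel
  rw [← Units.mul_eq_one_iff_eq_inv]
  exact h

include hg in
theorem IsPivot.antipode_inv : antipode ℂ ((g⁻¹ : Uˣ) : U) = g := by
  rw [← hg.antipode_coe, hg.grouplike.antipode_antipode]

theorem antipodeInv_mul (g : Uˣ) (x y : U) :
    antipodeInv g (x * y) = antipodeInv g y * antipodeInv g x := by
  simp [antipodeInv_apply, antipode_mul_antidistrib, mul_assoc]

theorem antipodeInv_one (g : Uˣ) : antipodeInv g (1 : U) = 1 := by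
  simp [antipodeInv_apply]

include hg in
theorem IsPivot.antipode_antipodeInv (x : U) : antipode ℂ (antipodeInv g x) = x := by
  simp [antipodeInv_apply, antipode_mul_antidistrib, hg.antipode_coe, hg.antipode_inv,
    hg.antipode_sq, mul_assoc]

include hg in
theorem IsPivot.antipodeInv_antipode (x : U) : antipodeInv g (antipode ℂ x) = x := by
  simp [antipodeInv_apply, hg.antipode_sq, mul_assoc]

include hg in
theorem IsPivot.antipodeInv_antipodeInv (x : U) :
    antipodeInv g (antipodeInv g x) = (g⁻¹ : Uˣ) * x * g := by
  rw [antipodeInv_apply g (antipodeInv g x), hg.antipode_antipodeInv, mul_assoc]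

-- Applying S turns S⁻¹(x₂) x₁ into S(x₁) x₂, so this is the antipode axiom.
include hg in
theorem IsPivot.mul_antipodeInv_comul (x : U) :
    (LinearMap.mul' ℂ U ∘ₗ (TensorProduct.comm ℂ U U).toLinearMap ∘ₗ
      (antipodeInv g).lTensor U) (comul x) = (counit (R := ℂ) x) • (1 : U) := by
  have h := sum_mul_antipode_eq_smul (ℛ ℂ x)
  apply (Function.LeftInverse.injective hg.antipodeInv_antipode)
  conv_lhs => rw [← (ℛ ℂ x).eq]
  rw [map_smul, antipode_one, ← sum_antipode_mul_eq_smul (ℛ ℂ x)]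
  simp [antipode_mul_antidistrib, hg.antipode_antipodeInv]

theorem lTensor_assoc_rTensor_comul (G : U ⊗[ℂ] U →ₗ[ℂ] U)
    (hG : ∀ x, G (comul x) = counit (R := ℂ) x • (1 : U)) (x : U) :
    G.lTensor U (TensorProduct.assoc ℂ U U U ((comul (R := ℂ)).rTensor U (comul x))) =
      x ⊗ₜ 1 := by
  have hG' : G ∘ₗ comul = (LinearMap.toSpanSingleton ℂ U 1) ∘ₗ counit := by
    ext y; simp [hG]
  rw [coassoc_apply, ← LinearMap.comp_apply, ← LinearMap.lTensor_comp, hG',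
    LinearMap.lTensor_comp, LinearMap.comp_apply, lTensor_counit_comul]
  simp

-- By coassociativity the sum is x₁ ⊗ S⁻¹(x₃) x₂, and the second leg collapses. This lets an element
-- cross from the first leg to the second in front of the coproduct of a cointegral;
-- `sum_comul_mul_antipode` does the same from behind.
include hg in
theorem IsPivot.sum_antipodeInv_mul_comul (x : U) :
    ∑ i ∈ (ℛ ℂ x).index, ((1 : U) ⊗ₜ[ℂ] antipodeInv g ((ℛ ℂ x).right i)) *
      comul ((ℛ ℂ x).left i) = x ⊗ₜ[ℂ] (1 : U) := by
  rw [← lTensor_assoc_rTensor_comul _ hg.mul_antipodeInv_comul x, ← (ℛ ℂ x).eq]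
  simp only [map_sum, LinearMap.rTensor_tmul]
  refine Finset.sum_congr rfl fun i _ => ?_
  induction comul (R := ℂ) ((ℛ ℂ x).left i) using TensorProduct.induction_on with
  | zero => simp
  | tmul a c => simp
  | add a c ha hc => rw [mul_add, ha, hc, TensorProduct.add_tmul, map_add, map_add]

theorem sum_comul_mul_antipode (x : U) :
    ∑ i ∈ (ℛ ℂ x).index, comul ((ℛ ℂ x).left i) *
      ((1 : U) ⊗ₜ[ℂ] antipode ℂ ((ℛ ℂ x).right i)) = x ⊗ₜ[ℂ] (1 : U) := by
  rw [← lTensor_assoc_rTensor_comul (LinearMap.mul' ℂ U ∘ₗ (antipode ℂ).lTensor U)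
    (fun y => by simp [Algebra.algebraMap_eq_smul_one]) x, ← (ℛ ℂ x).eq]
  simp only [map_sum, LinearMap.rTensor_tmul]
  refine Finset.sum_congr rfl fun i _ => ?_
  induction comul (R := ℂ) ((ℛ ℂ x).left i) using TensorProduct.induction_on with
  | zero => simp
  | tmul a c => simp
  | add a c ha hc => rw [add_mul, ha, hc, TensorProduct.add_tmul, map_add, map_add]

end Pivotal

/-! ### Homogeneous tensors -/

section Grading

variable {Λ : Type*} [AddCommGroup Λ] {U : Type*} [Ring U] [Algebra ℂ U]
variable (𝒰 : Λ → Submodule ℂ U)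

/-- The tensors of total degree `l`. -/
def totalDegree (l : Λ) : Submodule ℂ (U ⊗[ℂ] U) :=
  Submodule.span ℂ {t : U ⊗[ℂ] U |
    ∃ m n : Λ, m + n = l ∧ ∃ y ∈ 𝒰 m, ∃ z ∈ 𝒰 n, t = y ⊗ₜ[ℂ] z}

variable {𝒰}

theorem tmul_mem_totalDegree {m n l : Λ} (h : m + n = l) {x y : U} (hx : x ∈ 𝒰 m)
    (hy : y ∈ 𝒰 n) : x ⊗ₜ[ℂ] y ∈ totalDegree 𝒰 l :=
  Submodule.subset_span ⟨m, n, h, x, hx, y, hy, rfl⟩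

theorem exists_homogeneous_sum {l : Λ} {t : U ⊗[ℂ] U} (ht : t ∈ totalDegree 𝒰 l) :
    ∃ (ι : Type) (_ : Fintype ι) (x y : ι → U) (m n : ι → Λ), (∀ i, x i ∈ 𝒰 (m i)) ∧
      (∀ i, y i ∈ 𝒰 (n i)) ∧ (∀ i, m i + n i = l) ∧ t = ∑ i, x i ⊗ₜ[ℂ] y i := by
  induction ht using Submodule.span_induction with
  | mem t ht =>
    obtain ⟨m, n, h, x, hx, y, hy, rfl⟩ := ht
    exact ⟨Unit, inferInstance, fun _ => x, fun _ => y, fun _ => m, fun _ => n,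
      fun _ => hx, fun _ => hy, fun _ => h, by simp⟩
  | zero =>
    exact ⟨Empty, inferInstance, Empty.elim, Empty.elim, Empty.elim, Empty.elim,
      fun i => i.elim, fun i => i.elim, fun i => i.elim, by simp⟩
  | add s t _ _ hs ht =>
    obtain ⟨ι, _, x, y, m, n, hx, hy, h, rfl⟩ := hs
    obtain ⟨κ, _, x', y', m', n', hx', hy', h', rfl⟩ := ht
    exact ⟨ι ⊕ κ, inferInstance, Sum.elim x x', Sum.elim y y', Sum.elim m m', Sum.elim n n',
      fun i => by cases i <;> simp [hx, hx'], fun i => by cases i <;> simp [hy, hy'],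
      fun i => by cases i <;> simp [h, h'], by simp⟩
  | smul c t _ ht =>
    obtain ⟨ι, _, x, y, m, n, hx, hy, h, rfl⟩ := ht
    exact ⟨ι, inferInstance, fun i => c • x i, y, m, n, fun i => Submodule.smul_mem _ _ (hx i),
      hy, h, by simp [Finset.smul_sum, TensorProduct.smul_tmul']⟩

variable [DecidableEq Λ] [GradedAlgebra 𝒰]

theorem mul_mem_totalDegree {l m : Λ} {s t : U ⊗[ℂ] U} (hs : s ∈ totalDegree 𝒰 l)
    (ht : t ∈ totalDegree 𝒰 m) : s * t ∈ totalDegree 𝒰 (l + m) := by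
  obtain ⟨ι, _, x, y, a, b, hx, hy, h, rfl⟩ := exists_homogeneous_sum hs
  obtain ⟨κ, _, x', y', a', b', hx', hy', h', rfl⟩ := exists_homogeneous_sum ht
  rw [Finset.sum_mul_sum]
  refine Submodule.sum_mem _ fun i _ => Submodule.sum_mem _ fun k _ => ?_
  rw [Algebra.TensorProduct.tmul_mul_tmul]
  exact tmul_mem_totalDegree (by rw [← h i, ← h' k]; abel)
    (SetLike.GradedMul.mul_mem (hx i) (hx' k)) (SetLike.GradedMul.mul_mem (hy i) (hy' k))

theorem mul'_mem {l : Λ} {t : U ⊗[ℂ] U} (ht : t ∈ totalDegree 𝒰 l) :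
    LinearMap.mul' ℂ U t ∈ 𝒰 l := by
  obtain ⟨ι, _, x, y, m, n, hx, hy, h, rfl⟩ := exists_homogeneous_sum ht
  rw [map_sum]
  refine Submodule.sum_mem _ fun i _ => ?_
  rw [LinearMap.mul'_apply, ← h i]
  exact SetLike.GradedMul.mul_mem (hx i) (hy i)

variable (𝒰) in
theorem linearMap_ext_homogeneous {M : Type*} [AddCommGroup M] [Module ℂ M] {f f' : U →ₗ[ℂ] M}
    (h : ∀ l, ∀ x ∈ 𝒰 l, f x = f' x) : f = f' := by
  ext x
  induction x using DirectSum.Decomposition.inductionOn 𝒰 with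
  | zero => simp
  | add x y hx hy => rw [map_add, hx, hy, map_add]
  | homogeneous x => exact h _ _ x.2

variable (𝒰) in
theorem tensor_ext_homogeneous {M : Type*} [AddCommGroup M] [Module ℂ M]
    {f f' : U ⊗[ℂ] U →ₗ[ℂ] M}
    (h : ∀ l m, ∀ x ∈ 𝒰 l, ∀ y ∈ 𝒰 m, f (x ⊗ₜ y) = f' (x ⊗ₜ y)) : f = f' :=
  TensorProduct.ext (linearMap_ext_homogeneous 𝒰 fun l x hx =>
    linearMap_ext_homogeneous 𝒰 fun m y hy => h l m x hx y hy)

theorem proj_of_mem {l : Λ} {x : U} (hx : x ∈ 𝒰 l) : GradedAlgebra.proj 𝒰 l x = x := by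
  rw [GradedAlgebra.proj_apply, DirectSum.decompose_of_mem_same 𝒰 hx]

theorem proj_of_mem_ne {l m : Λ} (h : l ≠ m) {x : U} (hx : x ∈ 𝒰 l) :
    GradedAlgebra.proj 𝒰 m x = 0 := by
  rw [GradedAlgebra.proj_apply, DirectSum.decompose_of_mem_ne 𝒰 hx h]

theorem proj_mem (l : Λ) (x : U) : GradedAlgebra.proj 𝒰 l x ∈ 𝒰 l := by
  rw [GradedAlgebra.proj_apply]; exact SetLike.coe_mem _

theorem map_proj_of_mem_totalDegree {l m n : Λ} (h : m + n ≠ l) {t : U ⊗[ℂ] U}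
    (ht : t ∈ totalDegree 𝒰 l) :
    TensorProduct.map (GradedAlgebra.proj 𝒰 m) (GradedAlgebra.proj 𝒰 n) t = 0 := by
  obtain ⟨ι, _, x, y, a, b, hx, hy, hl, rfl⟩ := exists_homogeneous_sum ht
  rw [map_sum]
  refine Finset.sum_eq_zero fun i _ => ?_
  rw [TensorProduct.map_tmul]
  by_cases ha : a i = m
  · by_cases hb : b i = n
    · exact absurd (by rw [← ha, ← hb, hl]) h
    · rw [proj_of_mem_ne hb (hy i), TensorProduct.tmul_zero]
  · rw [proj_of_mem_ne ha (hx i), TensorProduct.zero_tmul]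

variable (𝒰) in
theorem exists_eq_sum_proj (x : U) : ∃ s : Finset Λ, ∀ s', s ⊆ s' →
    x = ∑ m ∈ s', GradedAlgebra.proj 𝒰 m x := by
  classical
  refine ⟨(DirectSum.decompose 𝒰 x).support, fun s' hs => ?_⟩
  conv_lhs => rw [← DirectSum.sum_support_decompose 𝒰 x]
  refine Finset.sum_subset hs fun m _ hm => ?_
  simpa using hm

variable (𝒰) in
theorem exists_eq_sum_map_proj (t : U ⊗[ℂ] U) : ∃ s : Finset Λ, ∀ s', s ⊆ s' →
    t = ∑ m ∈ s', ∑ n ∈ s',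
      TensorProduct.map (GradedAlgebra.proj 𝒰 m) (GradedAlgebra.proj 𝒰 n) t := by
  induction t using TensorProduct.induction_on with
  | zero => exact ⟨∅, fun _ _ => by simp⟩
  | tmul x y =>
    obtain ⟨s, hs⟩ := exists_eq_sum_proj 𝒰 x
    obtain ⟨s₁, hs₁⟩ := exists_eq_sum_proj 𝒰 y
    refine ⟨s ∪ s₁, fun s' h => ?_⟩
    conv_lhs => rw [hs s' (Finset.union_subset_left h), hs₁ s' (Finset.union_subset_right h)]
    simp only [TensorProduct.sum_tmul, TensorProduct.tmul_sum, TensorProduct.map_tmul]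
    exact Finset.sum_comm
  | add t u ht hu =>
    obtain ⟨s, hs⟩ := ht
    obtain ⟨s₁, hs₁⟩ := hu
    refine ⟨s ∪ s₁, fun s' h => ?_⟩
    conv_lhs => rw [hs s' (Finset.union_subset_left h), hs₁ s' (Finset.union_subset_right h)]
    simp only [map_add, Finset.sum_add_distrib]

theorem mem_totalDegree_of_map_proj {l : Λ} {t : U ⊗[ℂ] U}
    (h : ∀ m n, m + n ≠ l →
      TensorProduct.map (GradedAlgebra.proj 𝒰 m) (GradedAlgebra.proj 𝒰 n) t = 0) :
    t ∈ totalDegree 𝒰 l := by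
  obtain ⟨s, hs⟩ := exists_eq_sum_map_proj 𝒰 t
  rw [hs s subset_rfl]
  refine Submodule.sum_mem _ fun m _ => Submodule.sum_mem _ fun n _ => ?_
  by_cases hmn : m + n = l
  · clear hs h
    induction t using TensorProduct.induction_on with
    | zero => simp
    | tmul x y => exact tmul_mem_totalDegree hmn (proj_mem _ _) (proj_mem _ _)
    | add t u ht hu => rw [map_add]; exact Submodule.add_mem _ ht hu
  · rw [h m n hmn]; exact Submodule.zero_mem _

end Grading

/-! ### Degrees of group-like elements -/

section GradedHopf

variable {Λ : Type*} [AddCommGroup Λ] [DecidableEq Λ] {U : Type*} [Ring U] [HopfAlgebra ℂ U]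
variable {𝒰 : Λ → Submodule ℂ U} [GradedAlgebra 𝒰]

theorem IsGradedHopf.map_proj_comul (h𝒰 : IsGradedHopf 𝒰) (m n : Λ) (x : U) :
    TensorProduct.map (GradedAlgebra.proj 𝒰 m) (GradedAlgebra.proj 𝒰 n) (comul x) =
      TensorProduct.map (GradedAlgebra.proj 𝒰 m) (GradedAlgebra.proj 𝒰 n)
        (comul (GradedAlgebra.proj 𝒰 (m + n) x)) := by
  induction x using DirectSum.Decomposition.inductionOn 𝒰 with
  | zero => simp
  | add x y hx hy => simp only [map_add, hx, hy]
  | @homogeneous l x =>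
    by_cases h : l = m + n
    · subst h; rw [proj_of_mem x.2]
    · rw [proj_of_mem_ne h x.2, map_zero, map_zero]
      exact map_proj_of_mem_totalDegree (Ne.symm h) (h𝒰.comul_mem l x x.2)

/-- If x has a nonzero component x_l, then Δx = x ⊗ x has the nonzero bidegree (l, l) part x_l ⊗
x_l. That part comes from Δ(x_{2l}), so x_{2l} ≠ 0. For l ≠ 0, iterating along 2^k l gives
infinitely many nonzero components, as Λ has no torsion. -/
theorem IsGradedHopf.groupLike_mem [IsAddTorsionFree Λ] (h𝒰 : IsGradedHopf 𝒰) {x : U}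
    (hx : IsGroupLikeElem ℂ x) : x ∈ 𝒰 0 := by
  have hmn : ∀ m n, GradedAlgebra.proj 𝒰 (m + n) x = 0 →
      GradedAlgebra.proj 𝒰 m x ⊗ₜ[ℂ] GradedAlgebra.proj 𝒰 n x = 0 := fun m n h => by
    have h1 := h𝒰.map_proj_comul m n x
    rwa [h, map_zero, map_zero, hx.comul_eq_tmul_self, TensorProduct.map_tmul] at h1
  have hpow : ∀ l, GradedAlgebra.proj 𝒰 l x ≠ 0 → ∀ k : ℕ,
      GradedAlgebra.proj 𝒰 (2 ^ k • l) x ≠ 0 := fun l hl k => by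
    induction k with
    | zero => simpa using hl
    | succ k ih =>
      intro h
      rw [pow_succ, mul_two, add_smul] at h
      -- For a linear form f, applying f ⊗ f to z ⊗ z = 0 gives f(z)² = 0, so every form kills z.
      refine ih ((Module.forall_dual_apply_eq_zero_iff ℂ _).1 fun f => ?_)
      have h2 := congrArg (TensorProduct.lift ((LinearMap.mul ℂ ℂ).compl₁₂ f f)) (hmn _ _ h)
      simpa using h2
  have hz : ∀ l, l ≠ 0 → GradedAlgebra.proj 𝒰 l x = 0 := fun l hl => by
    by_contra hne
    have hfin : Set.Finite {m | GradedAlgebra.proj 𝒰 m x ≠ 0} := by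
      classical
      refine (DirectSum.decompose 𝒰 x).support.finite_toSet.subset fun m hm => ?_
      simpa [GradedAlgebra.proj_apply] using hm
    refine Set.infinite_of_injective_forall_mem (f := fun k : ℕ => 2 ^ k • l) ?_
      (fun k => hpow l hne k) hfin
    intro k k' h
    have h' : ((2 ^ k : ℕ) : ℤ) • l = ((2 ^ k' : ℕ) : ℤ) • l := by
      rw [natCast_zsmul, natCast_zsmul]; exact h
    exact Nat.pow_right_injective le_rfl (Int.ofNat_inj.1 (smul_left_injective ℤ hl h'))
  obtain ⟨s, hs⟩ := exists_eq_sum_proj 𝒰 x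
  rw [hs s subset_rfl]
  refine Submodule.sum_mem _ fun m _ => ?_
  by_cases hm : m = 0
  · subst hm; exact proj_mem _ _
  · rw [hz m hm]; exact Submodule.zero_mem _

end GradedHopf

/-! ### The unrolled algebra and the first relation -/

section Unrolled

variable {Λ : Type*} [AddCommGroup Λ] {U : Type*} [Ring U] [HopfAlgebra ℂ U]
variable (𝒰 : Λ → Submodule ℂ U)

theorem Kel_zero (K : DualGroupAlgebra Λ →ₐc[ℂ] U) : Kel K 0 = 1 := by
  rw [Kel, ← AddMonoidAlgebra.one_def, map_one]

theorem Kel_add (K : DualGroupAlgebra Λ →ₐc[ℂ] U) (a a' : Module.Dual ℤ Λ) :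
    Kel K (a + a') = Kel K a * Kel K a' := by
  simp only [Kel]
  rw [← map_mul, AddMonoidAlgebra.single_mul_single, one_mul]

theorem isGroupLikeElem_Kel (K : DualGroupAlgebra Λ →ₐc[ℂ] U) (a : Module.Dual ℤ Λ) :
    IsGroupLikeElem ℂ (Kel K a) where
  counit_eq_one := Ubar.counit_Kel K a
  comul_eq_tmul_self := Ubar.comul_Kel K a

theorem antipode_Kel (K : DualGroupAlgebra Λ →ₐc[ℂ] U) (a : Module.Dual ℤ Λ) :
    antipode ℂ (Kel K a) = Kel K (-a) := by
  refine left_inv_eq_right_inv (isGroupLikeElem_Kel K a).antipode_mul_cancel ?_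
  rw [← Kel_add, add_neg_cancel, Kel_zero]

theorem UH.lift_incl {A : Type*} [Ring A] [Algebra ℂ A] (f : U →ₐ[ℂ] A) (h : Module.Dual ℤ Λ → A)
    (hadd hcomm hwt) (x : U) : UH.lift 𝒰 f h hadd hcomm hwt (UH.incl 𝒰 x) = f x := by
  change RingQuot.liftAlgHom ℂ _ (RingQuot.mkAlgHom ℂ _ (FreeAlgebra.ι ℂ (Sum.inl x))) = _
  rw [RingQuot.liftAlgHom_mkAlgHom_apply]
  simp

theorem UH.lift_cartan {A : Type*} [Ring A] [Algebra ℂ A] (f : U →ₐ[ℂ] A)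
    (h : Module.Dual ℤ Λ → A) (hadd hcomm hwt) (a : Module.Dual ℤ Λ) :
    UH.lift 𝒰 f h hadd hcomm hwt (UH.cartan 𝒰 a) = h a := by
  change RingQuot.liftAlgHom ℂ _ (RingQuot.mkAlgHom ℂ _ (FreeAlgebra.ι ℂ (Sum.inr a))) = _
  rw [RingQuot.liftAlgHom_mkAlgHom_apply]
  simp

theorem UH.comul_incl (h𝒰 : IsGradedHopf 𝒰) (x : U) : UH.comul 𝒰 h𝒰 (UH.incl 𝒰 x) =
    Algebra.TensorProduct.map (UH.incl 𝒰) (UH.incl 𝒰) (Coalgebra.comul x) :=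
  UH.lift_incl 𝒰 _ _ _ _ _ x

theorem UH.comul_cartan (h𝒰 : IsGradedHopf 𝒰) (a : Module.Dual ℤ Λ) :
    UH.comul 𝒰 h𝒰 (UH.cartan 𝒰 a) =
      UH.cartan 𝒰 a ⊗ₜ[ℂ] 1 + 1 ⊗ₜ[ℂ] UH.cartan 𝒰 a :=
  UH.lift_cartan 𝒰 _ _ _ _ _ a

variable [DecidableEq Λ] [GradedAlgebra 𝒰]

/-- The derivation of `𝒰` which multiplies the elements of degree `l` by `a(l)`. -/
def degreeDerivation (a : Module.Dual ℤ Λ) : U →ₗ[ℂ] U :=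
  byDegree 𝒰 fun l => ((a l : ℤ) : ℂ) • LinearMap.id

theorem degreeDerivation_of_mem (a : Module.Dual ℤ Λ) {l : Λ} {x : U} (hx : x ∈ 𝒰 l) :
    degreeDerivation 𝒰 a x = ((a l : ℤ) : ℂ) • x := by
  rw [degreeDerivation, byDegree_of_mem 𝒰 _ hx]; rfl

/-- The action of `𝒰^H` on `𝒰`, where `𝒰` acts by multiplication on the left and `H_a` as the
derivation `degreeDerivation 𝒰 a`. -/
def UH.regular : UH 𝒰 →ₐ[ℂ] Module.End ℂ U :=
  UH.lift 𝒰 (Algebra.lmul ℂ U) (degreeDerivation 𝒰)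
    (fun a a' => linearMap_ext_homogeneous 𝒰 fun l x hx => by
      simp [degreeDerivation_of_mem 𝒰 _ hx, add_smul])
    (fun a a' => linearMap_ext_homogeneous 𝒰 fun l x hx => by
      simp [degreeDerivation_of_mem 𝒰 _ hx, smul_smul, mul_comm])
    (fun a l x hx => linearMap_ext_homogeneous 𝒰 fun m y hy => by
      simp [degreeDerivation_of_mem 𝒰 _ hy,
        degreeDerivation_of_mem 𝒰 _ (SetLike.GradedMul.mul_mem hx hy), mul_add, add_comm]
      rw [add_smul, ← zsmul_eq_mul, ← Int.cast_smul_eq_zsmul ℂ, mul_smul_comm])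

/-- Acting on 1 in the representation `UH.regular` is a linear retraction of 𝒰 → 𝒰^H. Injectivity is
what brings the first R-matrix relation back to 𝒰 ⊗ 𝒰. -/
theorem UH.map_incl_injective : Function.Injective
    (Algebra.TensorProduct.map (UH.incl 𝒰) (UH.incl 𝒰)) := by
  let ρ : UH 𝒰 →ₗ[ℂ] U := LinearMap.applyₗ (1 : U) ∘ₗ (UH.regular 𝒰).toLinearMap
  have hρ : ∀ x, ρ (UH.incl 𝒰 x) = x := fun x => by
    change UH.regular 𝒰 (UH.incl 𝒰 x) 1 = x
    rw [UH.regular, UH.lift_incl]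
    simp
  refine Function.LeftInverse.injective (g := TensorProduct.map ρ ρ) fun t => ?_
  induction t using TensorProduct.induction_on with
  | zero => simp
  | tmul x y => simp [hρ]
  | add s t hs ht => rw [map_add, map_add, hs, ht]

theorem UH.components_incl {l : Λ} {x : U} (hx : x ∈ 𝒰 l) :
    UH.components 𝒰 (UH.incl 𝒰 x) = Finsupp.single l (UH.incl 𝒰 x) := by
  have h : UH.grading 𝒰 (UH.incl 𝒰 x) = AddMonoidAlgebra.single l (UH.incl 𝒰 x) := by
    rw [UH.grading, UH.lift_incl, AlgHom.ofLinearMap_apply, byDegree_of_mem 𝒰 _ hx]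
    rfl
  change (UH.grading 𝒰 (UH.incl 𝒰 x)).coeff = _
  rw [h]
  rfl

theorem UH.components_cartan (a : Module.Dual ℤ Λ) :
    UH.components 𝒰 (UH.cartan 𝒰 a) = Finsupp.single 0 (UH.cartan 𝒰 a) := by
  have h : UH.grading 𝒰 (UH.cartan 𝒰 a) = AddMonoidAlgebra.single 0 (UH.cartan 𝒰 a) := by
    rw [UH.grading, UH.lift_cartan]
  change (UH.grading 𝒰 (UH.cartan 𝒰 a)).coeff = _
  rw [h]
  rfl

theorem UH.twist_tmul (K : DualGroupAlgebra Λ →ₐc[ℂ] U) (B : Λ →ₗ[ℤ] Λ →ₗ[ℤ] ℤ) {l m : Λ}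
    {x y : UH 𝒰} (hx : UH.components 𝒰 x = Finsupp.single l x)
    (hy : UH.components 𝒰 y = Finsupp.single m y) :
    UH.twist 𝒰 K B (x ⊗ₜ y) =
      (x * UH.incl 𝒰 (Kel K (B m))) ⊗ₜ (UH.incl 𝒰 (Kel K (B l)) * y) := by
  rw [UH.twist, TensorProduct.lift.tmul, LinearMap.compl₁₂_apply, hx, hy]
  simp

/-- The map `x ⊗ y ↦ x B_{|y|} ⊗ B_{|x|} y` (`x`, `y` homogeneous) on `𝒰 ⊗ 𝒰`. -/
def cartanTwist (K : DualGroupAlgebra Λ →ₐc[ℂ] U) (B : Λ →ₗ[ℤ] Λ →ₗ[ℤ] ℤ) :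
    U ⊗[ℂ] U →ₗ[ℂ] U ⊗[ℂ] U :=
  TensorProduct.lift (byDegree 𝒰 fun l => (byDegree 𝒰 fun m =>
    ((TensorProduct.mk ℂ U U).compl₁₂ (LinearMap.mulRight ℂ (Kel K (B m)))
      (LinearMap.mulLeft ℂ (Kel K (B l)))).flip).flip)

theorem cartanTwist_tmul (K : DualGroupAlgebra Λ →ₐc[ℂ] U) (B : Λ →ₗ[ℤ] Λ →ₗ[ℤ] ℤ) {l m : Λ}
    {x y : U} (hx : x ∈ 𝒰 l) (hy : y ∈ 𝒰 m) :
    cartanTwist 𝒰 K B (x ⊗ₜ y) = (x * Kel K (B m)) ⊗ₜ (Kel K (B l) * y) := by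
  rw [cartanTwist, TensorProduct.lift.tmul, byDegree_of_mem 𝒰 _ hx, LinearMap.flip_apply,
    byDegree_of_mem 𝒰 _ hy]
  rfl

theorem twist_map_incl (K : DualGroupAlgebra Λ →ₐc[ℂ] U) (B : Λ →ₗ[ℤ] Λ →ₗ[ℤ] ℤ)
    (t : U ⊗[ℂ] U) :
    UH.twist 𝒰 K B (Algebra.TensorProduct.map (UH.incl 𝒰) (UH.incl 𝒰) t) =
      Algebra.TensorProduct.map (UH.incl 𝒰) (UH.incl 𝒰) (cartanTwist 𝒰 K B t) := by
  have h : UH.twist 𝒰 K B ∘ₗ (Algebra.TensorProduct.map (UH.incl 𝒰) (UH.incl 𝒰)).toLinearMap =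
      (Algebra.TensorProduct.map (UH.incl 𝒰) (UH.incl 𝒰)).toLinearMap ∘ₗ
        cartanTwist 𝒰 K B := by
    refine tensor_ext_homogeneous 𝒰 fun l m x hx y hy => ?_
    simp [UH.twist_tmul 𝒰 K B (UH.components_incl 𝒰 hx) (UH.components_incl 𝒰 hy),
      cartanTwist_tmul 𝒰 K B hx hy]
  exact LinearMap.congr_fun h t

omit [DecidableEq Λ] [GradedAlgebra 𝒰] in
theorem comm_map_incl (t : U ⊗[ℂ] U) :
    TensorProduct.comm ℂ (UH 𝒰) (UH 𝒰)
      (Algebra.TensorProduct.map (UH.incl 𝒰) (UH.incl 𝒰) t) =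
      Algebra.TensorProduct.map (UH.incl 𝒰) (UH.incl 𝒰) (TensorProduct.comm ℂ U U t) := by
  induction t using TensorProduct.induction_on with
  | zero => simp
  | tmul x y => simp
  | add s t hs ht => simp only [map_add, hs, ht]

/-- The degree derivation of `𝒰 ⊗ 𝒰`. -/
def tensorDegreeDerivation (a : Module.Dual ℤ Λ) : U ⊗[ℂ] U →ₗ[ℂ] U ⊗[ℂ] U :=
  (degreeDerivation 𝒰 a).rTensor U + (degreeDerivation 𝒰 a).lTensor U

theorem tensorDegreeDerivation_tmul (a : Module.Dual ℤ Λ) {l m : Λ} {x y : U} (hx : x ∈ 𝒰 l)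
    (hy : y ∈ 𝒰 m) :
    tensorDegreeDerivation 𝒰 a (x ⊗ₜ y) = ((a (l + m) : ℤ) : ℂ) • (x ⊗ₜ[ℂ] y) := by
  simp only [tensorDegreeDerivation, LinearMap.add_apply, LinearMap.rTensor_tmul,
    LinearMap.lTensor_tmul, degreeDerivation_of_mem 𝒰 a hx, degreeDerivation_of_mem 𝒰 a hy,
    TensorProduct.tmul_smul, ← TensorProduct.smul_tmul', ← add_smul, map_add, Int.cast_add]

theorem cartan_mul_map_incl (a : Module.Dual ℤ Λ) (t : U ⊗[ℂ] U) :
    (UH.cartan 𝒰 a ⊗ₜ[ℂ] 1 + 1 ⊗ₜ[ℂ] UH.cartan 𝒰 a) *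
      Algebra.TensorProduct.map (UH.incl 𝒰) (UH.incl 𝒰) t =
    Algebra.TensorProduct.map (UH.incl 𝒰) (UH.incl 𝒰) t *
      (UH.cartan 𝒰 a ⊗ₜ[ℂ] 1 + 1 ⊗ₜ[ℂ] UH.cartan 𝒰 a) +
    Algebra.TensorProduct.map (UH.incl 𝒰) (UH.incl 𝒰) (tensorDegreeDerivation 𝒰 a t) := by
  set ι := Algebra.TensorProduct.map (UH.incl 𝒰) (UH.incl 𝒰)
  set h : UH 𝒰 ⊗[ℂ] UH 𝒰 := UH.cartan 𝒰 a ⊗ₜ[ℂ] 1 + 1 ⊗ₜ[ℂ] UH.cartan 𝒰 a with hh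
  have key : LinearMap.mulLeft ℂ h ∘ₗ ι.toLinearMap = LinearMap.mulRight ℂ h ∘ₗ ι.toLinearMap +
      ι.toLinearMap ∘ₗ tensorDegreeDerivation 𝒰 a := by
    refine tensor_ext_homogeneous 𝒰 fun l m x hx y hy => ?_
    simp only [LinearMap.comp_apply, LinearMap.add_apply, LinearMap.mulLeft_apply,
      LinearMap.mulRight_apply, AlgHom.toLinearMap_apply, tensorDegreeDerivation_tmul 𝒰 a hx hy,
      map_smul, ι, Algebra.TensorProduct.map_tmul, hh, add_mul, mul_add,
      Algebra.TensorProduct.tmul_mul_tmul, one_mul, mul_one, UH.cartan_mul_incl a hx,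
      UH.cartan_mul_incl a hy, TensorProduct.add_tmul, TensorProduct.tmul_add,
      Algebra.algebraMap_eq_smul_one, mul_smul_comm, map_add, Int.cast_add,
      TensorProduct.tmul_smul, ← TensorProduct.smul_tmul', add_smul]
    abel
  exact LinearMap.congr_fun key t

/-- Multiplication by elements K^a of degree 0 does not change degrees, so the second twist uses the
same bidegree as the first. -/
theorem cartanTwist_neg_cartanTwist (K : DualGroupAlgebra Λ →ₐc[ℂ] U)
    (hK : ∀ a, Kel K a ∈ 𝒰 0) (B : Λ →ₗ[ℤ] Λ →ₗ[ℤ] ℤ) (t : U ⊗[ℂ] U) :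
    cartanTwist 𝒰 K (-B) (cartanTwist 𝒰 K B t) = t := by
  have h : cartanTwist 𝒰 K (-B) ∘ₗ cartanTwist 𝒰 K B = LinearMap.id := by
    refine tensor_ext_homogeneous 𝒰 fun l m x hx y hy => ?_
    have hx' : x * Kel K (B m) ∈ 𝒰 l := by
      simpa using SetLike.GradedMul.mul_mem hx (hK (B m))
    have hy' : Kel K (B l) * y ∈ 𝒰 m := by
      simpa using SetLike.GradedMul.mul_mem (hK (B l)) hy
    rw [LinearMap.comp_apply, cartanTwist_tmul 𝒰 K B hx hy, cartanTwist_tmul 𝒰 K _ hx' hy',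
      mul_assoc, ← Kel_add, ← mul_assoc, ← Kel_add]
    simp [Kel_zero]
  exact LinearMap.congr_fun h t

variable {𝒰} {K : DualGroupAlgebra Λ →ₐc[ℂ] U} {g : Uˣ} {B : Λ →ₗ[ℤ] Λ →ₗ[ℤ] ℤ}
  {Rc : (U ⊗[ℂ] U)ˣ} {h𝒰 : IsGradedHopf 𝒰}

theorem IsQuasiRMatrix.comm_comul (hR : IsQuasiRMatrix 𝒰 h𝒰 K g B Rc) (u : U) :
    TensorProduct.comm ℂ U U (comul u) =
      cartanTwist 𝒰 K B ((Rc : U ⊗[ℂ] U) * comul u * ((Rc⁻¹ : (U ⊗[ℂ] U)ˣ) : U ⊗[ℂ] U)) := by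
  apply UH.map_incl_injective 𝒰
  have h := hR.R1 (UH.incl 𝒰 u)
  rwa [UH.comul_incl, comm_map_incl, ← map_mul, ← map_mul, twist_map_incl] at h

theorem IsQuasiRMatrix.mul_comul_mul_inv (hR : IsQuasiRMatrix 𝒰 h𝒰 K g B Rc)
    (hK : ∀ a, Kel K a ∈ 𝒰 0) (u : U) :
    (Rc : U ⊗[ℂ] U) * comul u * ((Rc⁻¹ : (U ⊗[ℂ] U)ˣ) : U ⊗[ℂ] U) =
      cartanTwist 𝒰 K (-B) (TensorProduct.comm ℂ U U (comul u)) := by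
  rw [hR.comm_comul u, cartanTwist_neg_cartanTwist 𝒰 K hK]

/-- Take u = H_a in the first relation. The element h = H_a ⊗ 1 + 1 ⊗ H_a is fixed by the flip and
by the twist, its legs having degree 0, while R h R⁻¹ = h - D(R) R⁻¹ with D the degree derivation.
Hence the twist kills D(R) R⁻¹, and both the twist and R are invertible. -/
theorem IsQuasiRMatrix.tensorDegreeDerivation_eq_zero (hR : IsQuasiRMatrix 𝒰 h𝒰 K g B Rc)
    (hK : ∀ a, Kel K a ∈ 𝒰 0) (a : Module.Dual ℤ Λ) :
    tensorDegreeDerivation 𝒰 a (Rc : U ⊗[ℂ] U) = 0 := by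
  have h := hR.R1 (UH.cartan 𝒰 a)
  have hone : UH.components 𝒰 1 = Finsupp.single 0 1 := by
    simpa using UH.components_incl 𝒰 (SetLike.GradedOne.one_mem (A := 𝒰))
  have hB : UH.twist 𝒰 K B (UH.cartan 𝒰 a ⊗ₜ[ℂ] 1 + 1 ⊗ₜ[ℂ] UH.cartan 𝒰 a) =
      UH.cartan 𝒰 a ⊗ₜ[ℂ] 1 + 1 ⊗ₜ[ℂ] UH.cartan 𝒰 a := by
    rw [map_add, UH.twist_tmul 𝒰 K B (UH.components_cartan 𝒰 a) hone,
      UH.twist_tmul 𝒰 K B hone (UH.components_cartan 𝒰 a)]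
    simp [Kel_zero]
  have hR' := cartan_mul_map_incl 𝒰 a (Rc : U ⊗[ℂ] U)
  rw [UH.comul_cartan, eq_sub_of_add_eq hR'.symm, sub_mul, mul_assoc, ← map_mul, Units.mul_inv,
    map_one, mul_one, map_sub, hB, ← map_mul, twist_map_incl] at h
  have h1 : TensorProduct.comm ℂ (UH 𝒰) (UH 𝒰)
      (UH.cartan 𝒰 a ⊗ₜ[ℂ] 1 + 1 ⊗ₜ[ℂ] UH.cartan 𝒰 a) =
      UH.cartan 𝒰 a ⊗ₜ[ℂ] 1 + 1 ⊗ₜ[ℂ] UH.cartan 𝒰 a := by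
    simp [add_comm]
  rw [h1, eq_comm, sub_eq_self] at h
  have h2 := UH.map_incl_injective 𝒰 (h.trans (map_zero _).symm)
  have h3 := cartanTwist_neg_cartanTwist 𝒰 K hK B
    (tensorDegreeDerivation 𝒰 a (Rc : U ⊗[ℂ] U) * ((Rc⁻¹ : (U ⊗[ℂ] U)ˣ) : U ⊗[ℂ] U))
  rw [h2, map_zero] at h3
  exact (Units.mul_left_eq_zero _).1 h3.symm

/-- A nonzero total degree is detected by some coordinate of Λ, and the matching degree derivation
multiplies that component by a nonzero integer. As the derivation kills R, the component is zero. -/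
theorem IsQuasiRMatrix.mem_totalDegree {r : ℕ} (b : Module.Basis (Fin r) ℤ Λ)
    (hR : IsQuasiRMatrix 𝒰 h𝒰 K g B Rc) (hK : ∀ a, Kel K a ∈ 𝒰 0) :
    (Rc : U ⊗[ℂ] U) ∈ totalDegree 𝒰 0 := by
  refine mem_totalDegree_of_map_proj fun m n hmn => ?_
  obtain ⟨i, hi⟩ : ∃ i, b.coord i (m + n) ≠ 0 := by
    by_contra! hall
    exact hmn (b.forall_coord_eq_zero_iff.1 hall)
  have key : TensorProduct.map (GradedAlgebra.proj 𝒰 m) (GradedAlgebra.proj 𝒰 n) ∘ₗ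
      tensorDegreeDerivation 𝒰 (b.coord i) = ((b.coord i (m + n) : ℤ) : ℂ) •
      TensorProduct.map (GradedAlgebra.proj 𝒰 m) (GradedAlgebra.proj 𝒰 n) := by
    refine tensor_ext_homogeneous 𝒰 fun l l' x hx y hy => ?_
    rw [LinearMap.comp_apply, tensorDegreeDerivation_tmul 𝒰 _ hx hy, map_smul,
      LinearMap.smul_apply]
    by_cases h : m + n = l + l'
    · rw [h]
    · rw [map_proj_of_mem_totalDegree h (tmul_mem_totalDegree rfl hx hy), smul_zero, smul_zero]
  have h := LinearMap.congr_fun key (Rc : U ⊗[ℂ] U)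
  rw [LinearMap.comp_apply, hR.tensorDegreeDerivation_eq_zero hK, map_zero, LinearMap.smul_apply,
    eq_comm, smul_eq_zero] at h
  exact h.resolve_left (Int.cast_ne_zero.2 hi)

/-- A group-like element has degree 0, so the twist does nothing to x ⊗ x. -/
theorem IsQuasiRMatrix.commute_groupLike [IsAddTorsionFree Λ]
    (hR : IsQuasiRMatrix 𝒰 h𝒰 K g B Rc) (hK : ∀ a, Kel K a ∈ 𝒰 0) {x : U}
    (hx : IsGroupLikeElem ℂ x) : (Rc : U ⊗[ℂ] U) * (x ⊗ₜ x) = (x ⊗ₜ x) * (Rc : U ⊗[ℂ] U) := by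
  have h := hR.mul_comul_mul_inv hK x
  have h0 := h𝒰.groupLike_mem hx
  rw [hx.comul_eq_tmul_self, TensorProduct.comm_tmul, cartanTwist_tmul 𝒰 K _ h0 h0] at h
  rw [Units.mul_inv_eq_iff_eq_mul] at h
  simpa [Kel_zero] using h

end Unrolled

/-! ### The Drinfeld element of a quasi R-matrix -/

section Drinfeld

variable {U : Type*} [Ring U] [HopfAlgebra ℂ U]

/-- The map `x ⊗ y ↦ y S⁻¹(x)`, where `S⁻¹` is computed with the pivot `g`. -/
def mulAntipodeInv (g : Uˣ) : U ⊗[ℂ] U →ₗ[ℂ] U :=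
  TensorProduct.lift ((LinearMap.mul ℂ U).flip.compl₁₂ (antipodeInv g) LinearMap.id)

theorem mulAntipodeInv_tmul (g : Uˣ) (x y : U) :
    mulAntipodeInv g (x ⊗ₜ y) = y * antipodeInv g x := rfl

/-- The map `x ⊗ y ↦ S(x) y`. -/
def antipodeMul : U ⊗[ℂ] U →ₗ[ℂ] U :=
  LinearMap.mul' ℂ U ∘ₗ (antipode ℂ).rTensor U

theorem antipodeMul_tmul (x y : U) : antipodeMul (x ⊗ₜ[ℂ] y) = antipode ℂ x * y := rfl

theorem mulAntipodeInv_comul {g : Uˣ} (hg : IsPivot g) (x : U) :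
    mulAntipodeInv g (comul x) = counit (R := ℂ) x • (1 : U) := by
  apply (Function.LeftInverse.injective hg.antipodeInv_antipode)
  conv_lhs => rw [← (ℛ ℂ x).eq]
  rw [map_smul, antipode_one, ← sum_mul_antipode_eq_smul (ℛ ℂ x)]
  simp [antipode_mul_antidistrib, hg.antipode_antipodeInv, mulAntipodeInv_tmul]

theorem mulAntipodeInv_mul_comul {g : Uˣ} (hg : IsPivot g) (t : U ⊗[ℂ] U) (x : U) :
    mulAntipodeInv g (t * comul x) = counit (R := ℂ) x • mulAntipodeInv g t := by
  induction t using TensorProduct.induction_on with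
  | zero => simp
  | add s t hs ht => rw [add_mul, map_add, hs, ht, map_add, smul_add]
  | tmul a c =>
    have h : ∀ u : U ⊗[ℂ] U, mulAntipodeInv g ((a ⊗ₜ c) * u) =
        c * mulAntipodeInv g u * antipodeInv g a := fun u => by
      induction u using TensorProduct.induction_on with
      | zero => simp
      | tmul x y => simp [mulAntipodeInv_tmul, antipodeInv_mul, mul_assoc]
      | add s t hs ht => rw [mul_add, map_add, hs, ht, map_add, mul_add, add_mul]
    rw [h, mulAntipodeInv_comul hg, mulAntipodeInv_tmul]
    simp

variable {Λ : Type*} [AddCommGroup Λ] [DecidableEq Λ]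
variable {𝒰 : Λ → Submodule ℂ U} [GradedAlgebra 𝒰]
variable {K : DualGroupAlgebra Λ →ₐc[ℂ] U} {g : Uˣ} {B : Λ →ₗ[ℤ] Λ →ₗ[ℤ] ℤ}
  {Rc : (U ⊗[ℂ] U)ˣ} {h𝒰 : IsGradedHopf 𝒰}

omit [DecidableEq Λ] [GradedAlgebra 𝒰] in
theorem exists_balanced_sum {t : U ⊗[ℂ] U} (ht : t ∈ totalDegree 𝒰 0) :
    ∃ (ι : Type) (_ : Fintype ι) (x y : ι → U) (n : ι → Λ), (∀ i, x i ∈ 𝒰 (n i)) ∧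
      (∀ i, y i ∈ 𝒰 (-n i)) ∧ t = ∑ i, x i ⊗ₜ[ℂ] y i := by
  obtain ⟨ι, _, x, y, m, n, hx, hy, h, rfl⟩ := exists_homogeneous_sum ht
  exact ⟨ι, inferInstance, x, y, m, hx, fun i => neg_eq_of_add_eq_zero_right (h i) ▸ hy i, rfl⟩

/-! ### The inverse of the quasi R-matrix -/

section Inverse

variable {ι : Type} [Fintype ι] {x y : ι → U} {n : ι → Λ}

theorem IsQuasiRMatrix.comul_sum (hR : IsQuasiRMatrix 𝒰 h𝒰 K g B Rc)
    (hy : ∀ i, y i ∈ 𝒰 (-n i)) (hsum : (Rc : U ⊗[ℂ] U) = ∑ i, x i ⊗ₜ[ℂ] y i) :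
    ∑ i, TensorProduct.assoc ℂ U U U (comul (x i) ⊗ₜ[ℂ] y i) =
      ∑ i, (x i ⊗ₜ[ℂ] (Kel K (B (n i)) ⊗ₜ[ℂ] y i)) * ((1 : U) ⊗ₜ[ℂ] (Rc : U ⊗[ℂ] U)) := by
  have h := hR.R2
  conv_lhs at h => rw [hsum]
  conv_rhs at h => arg 1; rw [hsum]
  simpa [Finset.sum_mul, byDegree_of_mem 𝒰 _ (hy _)] using h

/-- Applying ε to the first leg of the second relation gives R = (∑ ε(x_i) B_{n_i} ⊗ y_i) R. Cancel
R, then apply ε to the first leg once more. -/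
theorem IsQuasiRMatrix.sum_counit_smul (hR : IsQuasiRMatrix 𝒰 h𝒰 K g B Rc)
    (hy : ∀ i, y i ∈ 𝒰 (-n i)) (hsum : (Rc : U ⊗[ℂ] U) = ∑ i, x i ⊗ₜ[ℂ] y i) :
    ∑ i, counit (R := ℂ) (x i) • y i = 1 := by
  have h := congrArg (TensorProduct.lid ℂ (U ⊗[ℂ] U) ∘ (counit (R := ℂ)).rTensor (U ⊗[ℂ] U))
    (hR.comul_sum hy hsum)
  have hl : ∀ (t : U ⊗[ℂ] U) (c : U), TensorProduct.lid ℂ (U ⊗[ℂ] U)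
      ((counit (R := ℂ)).rTensor (U ⊗[ℂ] U) (TensorProduct.assoc ℂ U U U (t ⊗ₜ[ℂ] c))) =
      TensorProduct.lid ℂ U ((counit (R := ℂ)).rTensor U t) ⊗ₜ[ℂ] c := fun t c => by
    induction t using TensorProduct.induction_on with
    | zero => simp
    | tmul a b => simp [TensorProduct.smul_tmul']
    | add s t hs ht => simp only [TensorProduct.add_tmul, map_add, hs, ht]
  simp only [Function.comp_apply, map_sum, hl, rTensor_counit_comul, TensorProduct.lid_tmul,
    one_smul, Algebra.TensorProduct.tmul_mul_tmul, mul_one, LinearMap.rTensor_tmul] at h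
  rw [← hsum] at h
  simp only [← smul_mul_assoc, ← Finset.sum_mul] at h
  replace h := (Units.mul_left_inj Rc).1 (h.symm.trans (one_mul _).symm)
  have h' := congrArg (TensorProduct.lid ℂ U ∘ (counit (R := ℂ)).rTensor U) h
  have hc : ∀ a, counit (R := ℂ) (Kel K a) = 1 := Ubar.counit_Kel K
  simpa [hc, Algebra.TensorProduct.one_def] using h'

/-- Contracting the first two legs of the second relation with a ⊗ c ↦ S(a) c turns its left side
into 1 ⊗ ∑ ε(x_i) y_i = 1 and its right side into the stated sum times R. -/
theorem IsQuasiRMatrix.inv_eq_sum (hR : IsQuasiRMatrix 𝒰 h𝒰 K g B Rc)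
    (hy : ∀ i, y i ∈ 𝒰 (-n i)) (hsum : (Rc : U ⊗[ℂ] U) = ∑ i, x i ⊗ₜ[ℂ] y i) :
    ((Rc⁻¹ : (U ⊗[ℂ] U)ˣ) : U ⊗[ℂ] U) =
      ∑ i, (antipode ℂ (x i) * Kel K (B (n i))) ⊗ₜ[ℂ] y i := by
  have hl : ∀ (t : U ⊗[ℂ] U) (c : U), (LinearMap.mul' ℂ U).rTensor U
      ((TensorProduct.assoc ℂ U U U).symm ((antipode ℂ).rTensor (U ⊗[ℂ] U)
        (TensorProduct.assoc ℂ U U U (t ⊗ₜ[ℂ] c)))) =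
      LinearMap.mul' ℂ U ((antipode ℂ).rTensor U t) ⊗ₜ[ℂ] c := fun t c => by
    induction t using TensorProduct.induction_on with
    | zero => simp
    | tmul a b => simp
    | add s t hs ht => simp only [TensorProduct.add_tmul, map_add, hs, ht]
  have hr : ∀ (a c d : U) (t : U ⊗[ℂ] U), (LinearMap.mul' ℂ U).rTensor U
      ((TensorProduct.assoc ℂ U U U).symm ((antipode ℂ).rTensor (U ⊗[ℂ] U)
        (a ⊗ₜ[ℂ] ((c ⊗ₜ[ℂ] d) * t)))) = ((antipode ℂ a * c) ⊗ₜ[ℂ] d) * t := fun a c d t => by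
    induction t using TensorProduct.induction_on with
    | zero => simp
    | tmul e f => simp [mul_assoc]
    | add s t hs ht => simp only [mul_add, TensorProduct.tmul_add, map_add, hs, ht]
  have h := congrArg ((LinearMap.mul' ℂ U).rTensor U ∘ (TensorProduct.assoc ℂ U U U).symm ∘
    (antipode ℂ).rTensor (U ⊗[ℂ] U)) (hR.comul_sum hy hsum)
  simp only [Function.comp_apply, map_sum, hl, mul_antipode_rTensor_comul_apply,
    Algebra.TensorProduct.tmul_mul_tmul, mul_one, hr, Algebra.algebraMap_eq_smul_one] at h
  simp only [TensorProduct.smul_tmul, ← TensorProduct.tmul_sum, hR.sum_counit_smul hy hsum,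
    ← Finset.sum_mul] at h
  rw [← Algebra.TensorProduct.one_def, eq_comm, Units.mul_eq_one_iff_eq_inv] at h
  exact h.symm

end Inverse

/-- The map `x ↦ B_{|x|} x B_{|x|}` (`x` homogeneous). -/
def cartanConj (𝒰 : Λ → Submodule ℂ U) [GradedAlgebra 𝒰] (K : DualGroupAlgebra Λ →ₐc[ℂ] U)
    (B : Λ →ₗ[ℤ] Λ →ₗ[ℤ] ℤ) : U →ₗ[ℂ] U :=
  byDegree 𝒰 fun l => LinearMap.mulLeft ℂ (Kel K (B l)) ∘ₗ LinearMap.mulRight ℂ (Kel K (B l))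

theorem cartanConj_of_mem {l : Λ} {x : U} (hx : x ∈ 𝒰 l) :
    cartanConj 𝒰 K B x = Kel K (B l) * (x * Kel K (B l)) := by
  rw [cartanConj, byDegree_of_mem 𝒰 _ hx]; rfl

theorem antipodeInv_mem [IsAddTorsionFree Λ] (h𝒰 : IsGradedHopf 𝒰) (hg : IsPivot g) {l : Λ}
    {x : U} (hx : x ∈ 𝒰 l) : antipodeInv g x ∈ 𝒰 l := by
  have h0 := h𝒰.groupLike_mem hg.grouplike
  have h1 : ((g⁻¹ : Uˣ) : U) ∈ 𝒰 0 := by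
    rw [← hg.antipode_coe]; exact h𝒰.antipode_mem 0 _ h0
  have h2 := SetLike.GradedMul.mul_mem h1 (SetLike.GradedMul.mul_mem (h𝒰.antipode_mem l x hx) h0)
  rwa [zero_add, add_zero] at h2

theorem mulAntipodeInv_mem [IsAddTorsionFree Λ] (h𝒰 : IsGradedHopf 𝒰) (hg : IsPivot g) {l : Λ}
    {t : U ⊗[ℂ] U} (ht : t ∈ totalDegree 𝒰 l) : mulAntipodeInv g t ∈ 𝒰 l := by
  obtain ⟨ι, _, x, y, m, n, hx, hy, h, rfl⟩ := exists_homogeneous_sum ht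
  rw [map_sum]
  refine Submodule.sum_mem _ fun i _ => ?_
  rw [mulAntipodeInv_tmul, ← h i, add_comm]
  exact SetLike.GradedMul.mul_mem (hy i) (antipodeInv_mem h𝒰 hg (hx i))

omit [DecidableEq Λ] in
theorem antipodeInv_Kel (hg : IsPivot g) (a : Module.Dual ℤ Λ) :
    antipodeInv g (Kel K a) = Kel K (-a) := by
  apply (Function.LeftInverse.injective hg.antipodeInv_antipode)
  rw [hg.antipode_antipodeInv, antipode_Kel, neg_neg]

/-- Apply Ψ to R Δ(w) = (twisted opposite coproduct of w) R. The left side gives ε(w) P. For w of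
degree q the right side is K^{-B(q)} times the sum, because K^{-B(n)} = K^{-B(q)} K^{B(m)} when m +
n = q, and P commutes with every K^a. The prefactor is 1 for q = 0; for q ≠ 0 it cancels, as ε(w) =
0. -/
theorem sum_cartanConj_mul [IsAddTorsionFree Λ] (hR : IsQuasiRMatrix 𝒰 h𝒰 K g B Rc)
    (hg : IsPivot g) (hK : ∀ a, Kel K a ∈ 𝒰 0) (hKc : ∀ a, ∀ x ∈ 𝒰 0, Commute (Kel K a) x)
    (hT : (Rc : U ⊗[ℂ] U) ∈ totalDegree 𝒰 0) (w : U) :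
    LinearMap.mul' ℂ U (TensorProduct.map
      (LinearMap.mulRight ℂ (mulAntipodeInv g (Rc : U ⊗[ℂ] U)) ∘ₗ cartanConj 𝒰 K B)
      (antipodeInv g) (comul w)) = counit (R := ℂ) w • mulAntipodeInv g (Rc : U ⊗[ℂ] U) := by
  set P := mulAntipodeInv g (Rc : U ⊗[ℂ] U) with hP
  have hP0 : P ∈ 𝒰 0 := mulAntipodeInv_mem h𝒰 hg hT
  have hmul : ∀ (a c : U) (t : U ⊗[ℂ] U), mulAntipodeInv g ((a ⊗ₜ c) * t) =
      c * mulAntipodeInv g t * antipodeInv g a := fun a c t => by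
    induction t using TensorProduct.induction_on with
    | zero => simp
    | tmul x y => simp [mulAntipodeInv_tmul, antipodeInv_mul, mul_assoc]
    | add s t hs ht => rw [mul_add, map_add, hs, ht, map_add, mul_add, add_mul]
  set F := LinearMap.mul' ℂ U ∘ₗ TensorProduct.map (LinearMap.mulRight ℂ P ∘ₗ cartanConj 𝒰 K B)
      (antipodeInv g) with hF
  have key : ∀ q, ∀ t ∈ totalDegree 𝒰 q,
      mulAntipodeInv g (cartanTwist 𝒰 K (-B) (TensorProduct.comm ℂ U U t) * Rc) =
        Kel K (-B q) * F t := fun q t ht => by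
    obtain ⟨ι, _, x, y, m, n, hx, hy, h, rfl⟩ := exists_homogeneous_sum ht
    simp only [map_sum, Finset.sum_mul, Finset.mul_sum, TensorProduct.comm_tmul]
    refine Finset.sum_congr rfl fun i _ => ?_
    have hB : Kel K (-B (n i)) = Kel K (-B q) * Kel K (B (m i)) := by
      rw [← Kel_add, ← h i, map_add]; congr 1; abel
    rw [cartanTwist_tmul 𝒰 K _ (hy i) (hx i), hmul, antipodeInv_mul, LinearMap.neg_apply,
      LinearMap.neg_apply, antipodeInv_Kel hg, neg_neg, hB, hF, LinearMap.comp_apply,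
      TensorProduct.map_tmul, LinearMap.mul'_apply, LinearMap.comp_apply,
      LinearMap.mulRight_apply, cartanConj_of_mem (hx i), ← hP]
    have hc := (hKc (B (m i)) P hP0).eq
    simp only [mul_assoc]
    rw [← mul_assoc P (Kel K (B (m i))), ← hc, mul_assoc]
  change F (comul w) = _
  have hlin : F ∘ₗ comul = (LinearMap.toSpanSingleton ℂ U P) ∘ₗ counit := by
    refine linearMap_ext_homogeneous 𝒰 fun q w hw => ?_
    have h1 := hR.mul_comul_mul_inv hK w
    rw [Units.mul_inv_eq_iff_eq_mul] at h1
    have h2 := congrArg (mulAntipodeInv g) h1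
    rw [mulAntipodeInv_mul_comul hg, key q _ (h𝒰.comul_mem q w hw)] at h2
    simp only [LinearMap.comp_apply, LinearMap.toSpanSingleton_apply]
    by_cases hq : q = 0
    · subst hq
      rw [h2, map_zero, neg_zero, Kel_zero, one_mul]
    · rw [h𝒰.counit_eq_zero q hq w hw, zero_smul] at h2 ⊢
      have h3 := congrArg (Kel K (B q) * ·) h2
      simp only [mul_zero, ← mul_assoc, ← Kel_add, add_neg_cancel, Kel_zero, one_mul] at h3
      exact h3.symm
  exact LinearMap.congr_fun hlin w

/-- The quasi analogue of the Drinfeld element implementing S². With c the map `cartanConj`,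
evaluate c(z₁) P S⁻¹(z₂) S⁻²(z₃) in two ways: collapsing z₁, z₂ by `sum_cartanConj_mul` gives P
S⁻²(z), and collapsing z₂, z₃ gives c(z) P. -/
theorem mulAntipodeInv_mul_conj [IsAddTorsionFree Λ] (hR : IsQuasiRMatrix 𝒰 h𝒰 K g B Rc)
    (hg : IsPivot g) (hK : ∀ a, Kel K a ∈ 𝒰 0) (hKc : ∀ a, ∀ x ∈ 𝒰 0, Commute (Kel K a) x)
    (hT : (Rc : U ⊗[ℂ] U) ∈ totalDegree 𝒰 0) (z : U) :
    mulAntipodeInv g (Rc : U ⊗[ℂ] U) * (((g⁻¹ : Uˣ) : U) * z * g) =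
      cartanConj 𝒰 K B z * mulAntipodeInv g (Rc : U ⊗[ℂ] U) := by
  have hA := sum_cartanConj_mul hR hg hK hKc hT
  set P := mulAntipodeInv g (Rc : U ⊗[ℂ] U) with hP
  set χ := LinearMap.mul' ℂ U ∘ₗ (TensorProduct.comm ℂ U U).toLinearMap ∘ₗ
      (antipodeInv g).lTensor U with hχ
  set F := LinearMap.mul' ℂ U ∘ₗ TensorProduct.map (LinearMap.mulRight ℂ P ∘ₗ cartanConj 𝒰 K B)
      (antipodeInv g) with hF
  let Θ := LinearMap.mul' ℂ U ∘ₗ TensorProduct.map (LinearMap.mulRight ℂ P ∘ₗ cartanConj 𝒰 K B)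
      (antipodeInv g ∘ₗ χ)
  have hΘ : ∀ (t : U ⊗[ℂ] U) (c : U), Θ (TensorProduct.assoc ℂ U U U (t ⊗ₜ c)) =
      F t * antipodeInv g (antipodeInv g c) := fun t c => by
    induction t using TensorProduct.induction_on with
    | zero => simp
    | tmul a b => simp [Θ, hF, hχ, antipodeInv_mul, mul_assoc]
    | add s t hs ht => rw [TensorProduct.add_tmul, map_add, map_add, hs, ht, map_add, add_mul]
  have h := congrArg Θ (coassoc_apply (R := ℂ) z)
  rw [← (ℛ ℂ z).eq] at h
  simp only [map_sum, LinearMap.rTensor_tmul, LinearMap.lTensor_tmul, hΘ] at h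
  have hl : ∀ w, F (comul w) = counit (R := ℂ) w • P := hA
  have hr : ∀ a w, Θ (a ⊗ₜ comul w) = counit (R := ℂ) w • (cartanConj 𝒰 K B a * P) := fun a w => by
    simp only [Θ, LinearMap.comp_apply, TensorProduct.map_tmul, LinearMap.mul'_apply,
      LinearMap.mulRight_apply]
    rw [hχ, hg.mul_antipodeInv_comul, map_smul, antipodeInv_one, mul_smul_comm, mul_one]
  simp only [hl, hr] at h
  have h1 : ∑ i ∈ (ℛ ℂ z).index, counit (R := ℂ) ((ℛ ℂ z).left i) • P *
      antipodeInv g (antipodeInv g ((ℛ ℂ z).right i)) = P * antipodeInv g (antipodeInv g z) := by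
    conv_rhs => rw [← sum_counit_smul (ℛ ℂ z)]
    simp [Finset.mul_sum]
  have h2 : ∑ i ∈ (ℛ ℂ z).index, counit (R := ℂ) ((ℛ ℂ z).right i) •
      (cartanConj 𝒰 K B ((ℛ ℂ z).left i) * P) = cartanConj 𝒰 K B z * P := by
    have h3 := congrArg (TensorProduct.rid ℂ U) (sum_tmul_counit_eq (ℛ ℂ z))
    simp only [map_sum, TensorProduct.rid_tmul, one_smul] at h3
    conv_rhs => rw [← h3]
    simp [Finset.sum_mul]
  rw [← hg.antipodeInv_antipodeInv, ← h1, ← h2, h]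

theorem IsQuasiRMatrix.mulAntipodeInv_mul_antipodeMul_inv [IsAddTorsionFree Λ]
    (hR : IsQuasiRMatrix 𝒰 h𝒰 K g B Rc) (hg : IsPivot g) (hK : ∀ a, Kel K a ∈ 𝒰 0)
    (hKc : ∀ a, ∀ x ∈ 𝒰 0, Commute (Kel K a) x)
    (hT : (Rc : U ⊗[ℂ] U) ∈ totalDegree 𝒰 0) :
    mulAntipodeInv g (Rc : U ⊗[ℂ] U) *
      antipodeMul ((Rc⁻¹ : (U ⊗[ℂ] U)ˣ) : U ⊗[ℂ] U) = (g : U) ^ 2 := by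
  have hconj := mulAntipodeInv_mul_conj hR hg hK hKc hT
  have hP0 : mulAntipodeInv g (Rc : U ⊗[ℂ] U) ∈ 𝒰 0 := mulAntipodeInv_mem h𝒰 hg hT
  obtain ⟨ι, _, x, y, n, hx, hy, hsum⟩ := exists_balanced_sum hT
  have hinv := hR.inv_eq_sum hy hsum
  have hg0 : (g : U) ∈ 𝒰 0 := h𝒰.groupLike_mem hg.grouplike
  have hg0' : ((g⁻¹ : Uˣ) : U) ∈ 𝒰 0 := by
    rw [← hg.antipode_coe]; exact h𝒰.antipode_mem 0 _ hg0
  -- This is Ψ(R⁻¹ R) = 1, with the explicit sum inserted for R⁻¹.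
  have hone : ∑ i, y i * mulAntipodeInv g (Rc : U ⊗[ℂ] U) * Kel K (-B (n i)) * x i = 1 := by
    have h1 : mulAntipodeInv g (((Rc⁻¹ : (U ⊗[ℂ] U)ˣ) : U ⊗[ℂ] U) * Rc) = 1 := by
      rw [Units.inv_mul, Algebra.TensorProduct.one_def, mulAntipodeInv_tmul, antipodeInv_one,
        one_mul]
    rw [← h1, hinv]
    conv_lhs => rw [hsum]
    conv_rhs => rw [hsum, Finset.sum_mul, map_sum]
    refine Finset.sum_congr rfl fun i _ => ?_
    simp only [Finset.mul_sum, map_sum, Finset.sum_mul, Algebra.TensorProduct.tmul_mul_tmul,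
      mulAntipodeInv_tmul, antipodeInv_mul, hg.antipodeInv_antipode, antipodeInv_Kel hg, mul_assoc]
  set P := mulAntipodeInv g (Rc : U ⊗[ℂ] U) with hP
  let ρ : U →ₗ[ℂ] U := byDegree 𝒰 fun l => LinearMap.mulRight ℂ (Kel K (B l))
  have hρ : ∀ {l : Λ} {z : U}, z ∈ 𝒰 l → ρ z = z * Kel K (B l) := fun hz => by
    simp only [ρ]; rw [byDegree_of_mem 𝒰 _ hz]; rfl
  let Ω : U ⊗[ℂ] U →ₗ[ℂ] U := LinearMap.mul' ℂ U ∘ₗ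
    TensorProduct.map (LinearMap.mulRight ℂ P ∘ₗ cartanConj 𝒰 K B) ρ ∘ₗ
      (TensorProduct.comm ℂ U U).toLinearMap
  have hΩ : ∀ a c, Ω (a ⊗ₜ c) = cartanConj 𝒰 K B c * P * ρ a := fun a c => rfl
  -- Each summand of Ω(R) is a summand of `hone` conjugated by K^{-B(n_i)}; these have degree 0, so
  -- the conjugation is trivial.
  have hΩR : Ω (Rc : U ⊗[ℂ] U) = 1 := by
    rw [hsum, map_sum, ← hone]
    refine Finset.sum_congr rfl fun i _ => ?_
    have hdeg : y i * P * Kel K (-B (n i)) * x i ∈ 𝒰 0 := by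
      simpa using SetLike.GradedMul.mul_mem (SetLike.GradedMul.mul_mem
        (SetLike.GradedMul.mul_mem (hy i) hP0) (hK (-B (n i)))) (hx i)
    have hc := (hKc (-B (n i)) _ hdeg).eq
    have hcP := (hKc (-B (n i)) P hP0).eq
    have hKK : Kel K (-B (n i)) * Kel K (B (n i)) = 1 := by
      rw [← Kel_add, neg_add_cancel, Kel_zero]
    rw [hΩ, cartanConj_of_mem (hy i), hρ (hx i), map_neg]
    calc _ = Kel K (-B (n i)) * (y i * (Kel K (-B (n i)) * P) * x i) * Kel K (B (n i)) := by
          simp only [mul_assoc]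
      _ = Kel K (-B (n i)) * (y i * P * Kel K (-B (n i)) * x i) * Kel K (B (n i)) := by
          rw [hcP]; simp only [mul_assoc]
      _ = _ := by rw [hc, mul_assoc, hKK, mul_one]
  have hinvar : (((g : U) ^ 2) ⊗ₜ[ℂ] ((g : U) ^ 2)) * (Rc : U ⊗[ℂ] U) *
      ((((g⁻¹ : Uˣ) : U) ^ 2) ⊗ₜ[ℂ] (((g⁻¹ : Uˣ) : U) ^ 2)) = Rc := by
    rw [← hR.commute_groupLike hK (hg.grouplike.pow (n := 2)), mul_assoc, Algebra.TensorProduct.tmul_mul_tmul,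
      ← Units.val_pow_eq_pow_val, ← Units.val_pow_eq_pow_val, inv_pow, Units.mul_inv,
      ← Algebra.TensorProduct.one_def, mul_one]
  have h4 := hR.R4
  conv at h4 => lhs; rw [hsum]
  conv at h4 => rhs; rw [hsum]
  simp only [map_sum, TensorProduct.lift.tmul, byDegree_of_mem 𝒰 _ (hx _)] at h4
  simp only [LinearMap.compl₁₂_apply, LinearMap.flip_apply, LinearMap.mul_apply',
    LinearMap.comp_apply, LinearMap.mulLeft_apply, LinearMap.mulRight_apply,
    LinearMap.id_apply] at h4
  -- Φ(R⁻¹) = ∑ B_{n_i}⁻¹ g x_i g⁻¹ y_i. Moving B_{n_i}⁻¹ past degree 0 factors leaves g times one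
  -- side of the fourth relation.
  have hP' : antipodeMul ((Rc⁻¹ : (U ⊗[ℂ] U)ˣ) : U ⊗[ℂ] U) =
      ∑ i, g * (y i * (g * (x i * Kel K (B (n i))))) := by
    rw [← Finset.mul_sum, h4, hinv, map_sum, Finset.mul_sum]
    refine Finset.sum_congr rfl fun i _ => ?_
    have hdeg : x i * ((g⁻¹ : Uˣ) : U) * y i ∈ 𝒰 0 := by
      simpa using SetLike.GradedMul.mul_mem (SetLike.GradedMul.mul_mem (hx i) hg0') (hy i)
    rw [antipodeMul_tmul, antipode_mul_antidistrib, hg.antipode_sq, antipode_Kel, map_neg]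
    calc _ = Kel K (-B (n i)) * g * (x i * ((g⁻¹ : Uˣ) : U) * y i) := by simp only [mul_assoc]
      _ = g * (Kel K (-B (n i)) * (x i * ((g⁻¹ : Uˣ) : U) * y i)) := by
          rw [(hKc _ _ hg0).eq, mul_assoc]
      _ = _ := by rw [(hKc _ _ hdeg).eq]; simp only [mul_assoc]
  rw [hP', Finset.mul_sum]
  -- With z = g² y_i g⁻² one has g y_i g⁻¹ = g⁻¹ z g, so `hconj` moves P past it. The remaining g²
  -- is carried to the right end, which conjugates x_i by g² too.
  have hterm : ∀ i, P * (g * (y i * (g * (x i * Kel K (B (n i)))))) =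
      Ω (((g : U) ^ 2 * x i * ((g⁻¹ : Uˣ) : U) ^ 2) ⊗ₜ
        ((g : U) ^ 2 * y i * ((g⁻¹ : Uˣ) : U) ^ 2)) * (g : U) ^ 2 := fun i => by
    have hz := hconj ((g : U) ^ 2 * y i * ((g⁻¹ : Uˣ) : U) ^ 2)
    have hdx : (g : U) ^ 2 * x i * ((g⁻¹ : Uˣ) : U) ^ 2 ∈ 𝒰 (n i) := by
      have h2 := SetLike.GradedMul.mul_mem (SetLike.GradedMul.mul_mem
        (SetLike.GradedMul.mul_mem hg0 hg0) (hx i)) (SetLike.GradedMul.mul_mem hg0' hg0')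
      rwa [add_zero, add_zero, zero_add, ← sq, ← sq] at h2
    have hg2 : (g : U) ^ 2 ∈ 𝒰 0 := by
      rw [sq]; simpa using SetLike.GradedMul.mul_mem hg0 hg0
    have hK2 := hKc (B (n i)) _ hg2
    rw [hΩ, hρ hdx, ← hz]
    have e1 : ((g⁻¹ : Uˣ) : U) ^ 2 * (g : U) ^ 2 = 1 := by
      rw [← Units.val_pow_eq_pow_val, ← Units.val_pow_eq_pow_val, inv_pow, Units.inv_mul]
    simp only [mul_assoc, hK2.eq]
    simp [pow_two, mul_assoc]
  simp only [hterm, ← Finset.sum_mul, ← map_sum]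
  have hfin : ∑ i, ((g : U) ^ 2 * x i * ((g⁻¹ : Uˣ) : U) ^ 2) ⊗ₜ[ℂ]
      ((g : U) ^ 2 * y i * ((g⁻¹ : Uˣ) : U) ^ 2) = Rc := by
    conv_rhs => rw [← hinvar, hsum]
    simp [Finset.mul_sum, Finset.sum_mul]
  rw [hfin, hΩR, one_mul]

end Drinfeld

/-! ### Integrals of a family of quotients of a Hopf algebra -/

section Integrals

variable {U : Type*} [Ring U] [HopfAlgebra ℂ U]

/-- The map `x ⊗ y ↦ f(x) φ(y)`. -/
def slice {V V' A : Type*} [AddCommGroup V] [Module ℂ V] [AddCommGroup V'] [Module ℂ V']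
    [AddCommGroup A] [Module ℂ A] (f : V →ₗ[ℂ] ℂ) (φ : V' →ₗ[ℂ] A) : V ⊗[ℂ] V' →ₗ[ℂ] A :=
  (TensorProduct.lid ℂ A).toLinearMap ∘ₗ TensorProduct.map f φ

@[simp]
theorem slice_tmul {V V' A : Type*} [AddCommGroup V] [Module ℂ V] [AddCommGroup V'] [Module ℂ V']
    [AddCommGroup A] [Module ℂ A] (f : V →ₗ[ℂ] ℂ) (φ : V' →ₗ[ℂ] A) (x : V) (y : V') :
    slice f φ (x ⊗ₜ y) = f x • φ y := by
  simp [slice]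

theorem exists_comp_eq {V A : Type*} [AddCommGroup V] [Module ℂ V] [AddCommGroup A] [Module ℂ A]
    (f : V →ₗ[ℂ] ℂ) (φ : V →ₗ[ℂ] A) (hφ : Function.Surjective φ)
    (hf : ∀ x, φ x = 0 → f x = 0) : ∃ f' : A →ₗ[ℂ] ℂ, f = f' ∘ₗ φ := by
  obtain ⟨s, hs⟩ := φ.exists_rightInverse_of_surjective (LinearMap.range_eq_top.2 hφ)
  refine ⟨f ∘ₗ s, LinearMap.ext fun x => ?_⟩
  have h := hf (x - s (φ x)) (by
    rw [map_sub, sub_eq_zero]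
    exact (LinearMap.congr_fun hs (φ x)).symm)
  rw [map_sub, sub_eq_zero] at h
  exact h

variable {G : Type*} [AddCommGroup G] {A : G → Type*} [∀ α, Ring (A α)] [∀ α, Algebra ℂ (A α)]

/-- A family of finite-dimensional quotients `π_α : U → A_α` such that the comultiplication of `U`
induces maps `A_{α+β} → A_α ⊗ A_β`. -/
structure IsQuotientFamily (π : ∀ α, U →ₐ[ℂ] A α) : Prop where
  surjective : ∀ α, Function.Surjective (π α)
  map_comul_eq_zero : ∀ α β x, π (α + β) x = 0 →
    Algebra.TensorProduct.map (π α) (π β) (comul (R := ℂ) x) = 0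
  finite : ∀ α, FiniteDimensional ℂ (A α)

/-- Linear forms on `U` which induce a right `G`-integral of the quotients `A_α`. -/
structure IsIntegralLift (π : ∀ α, U →ₐ[ℂ] A α) (L : G → U →ₗ[ℂ] ℂ) : Prop where
  eq_zero : ∀ α x, π α x = 0 → L α x = 0
  slice_comul : ∀ α β x, slice (L α) (π β).toLinearMap (comul x) = L (α + β) x • 1

/-- An element of `U` which induces a two-sided cointegral of `A_0`, normalized by the form `f`. -/
structure IsCointegralLift (φ : U →ₐ[ℂ] A 0) (f : U →ₗ[ℂ] ℂ) (Y : U) : Prop where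
  left : ∀ x, φ (x * Y) = counit (R := ℂ) x • φ Y
  right : ∀ x, φ (Y * x) = counit (R := ℂ) x • φ Y
  norm : f Y = 1

/-- A form that vanishes on the kernel of π_α descends to A_α, so the contraction only sees the
image in A_α ⊗ A_β. -/
theorem slice_eq_of_map_eq {π : ∀ α, U →ₐ[ℂ] A α} (hπ : IsQuotientFamily π) {α β : G}
    {f : U →ₗ[ℂ] ℂ} (hf : ∀ x, π α x = 0 → f x = 0) {s t : U ⊗[ℂ] U}
    (h : Algebra.TensorProduct.map (π α) (π β) s = Algebra.TensorProduct.map (π α) (π β) t) :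
    slice f (π β).toLinearMap s = slice f (π β).toLinearMap t := by
  obtain ⟨f', rfl⟩ := exists_comp_eq f (π α).toLinearMap (hπ.surjective α) hf
  have hs : slice (f' ∘ₗ (π α).toLinearMap) (π β).toLinearMap =
      (TensorProduct.lid ℂ (A β)).toLinearMap ∘ₗ f'.rTensor (A β) ∘ₗ
        (Algebra.TensorProduct.map (π α) (π β)).toLinearMap := by
    ext x y; simp
  rw [hs]
  simp only [LinearMap.comp_apply, AlgHom.toLinearMap_apply, h]

theorem slice_one_tmul_mul (f : U →ₗ[ℂ] ℂ) {R : Type*} [Ring R] [Algebra ℂ R] (φ : U →ₐ[ℂ] R)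
    (z : U) (t : U ⊗[ℂ] U) :
    slice f φ.toLinearMap ((1 ⊗ₜ z) * t) = φ z * slice f φ.toLinearMap t := by
  induction t using TensorProduct.induction_on with
  | zero => simp
  | tmul x y => simp
  | add s t hs ht => rw [mul_add, map_add, hs, ht, map_add, mul_add]

theorem slice_mul_one_tmul (f : U →ₗ[ℂ] ℂ) {R : Type*} [Ring R] [Algebra ℂ R] (φ : U →ₐ[ℂ] R)
    (z : U) (t : U ⊗[ℂ] U) :
    slice f φ.toLinearMap (t * (1 ⊗ₜ z)) = slice f φ.toLinearMap t * φ z := by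
  induction t using TensorProduct.induction_on with
  | zero => simp
  | tmul x y => simp
  | add s t hs ht => rw [add_mul, map_add, hs, ht, map_add, add_mul]

theorem slice_tmul_one_mul (f : U →ₗ[ℂ] ℂ) {M : Type*} [AddCommGroup M] [Module ℂ M]
    (φ : U →ₗ[ℂ] M) (z : U) (t : U ⊗[ℂ] U) :
    slice f φ ((z ⊗ₜ 1) * t) = slice (f ∘ₗ LinearMap.mulLeft ℂ z) φ t := by
  induction t using TensorProduct.induction_on with
  | zero => simp
  | tmul x y => simp
  | add s t hs ht => rw [mul_add, map_add, hs, ht, map_add]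

theorem slice_mul_tmul_one (f : U →ₗ[ℂ] ℂ) {M : Type*} [AddCommGroup M] [Module ℂ M]
    (φ : U →ₗ[ℂ] M) (z : U) (t : U ⊗[ℂ] U) :
    slice f φ (t * (z ⊗ₜ 1)) = slice (f ∘ₗ LinearMap.mulRight ℂ z) φ t := by
  induction t using TensorProduct.induction_on with
  | zero => simp
  | tmul x y => simp
  | add s t hs ht => rw [add_mul, map_add, hs, ht, map_add]

/-! ### Contractions of the coproduct of a cointegral -/

variable {π : ∀ α, U →ₐ[ℂ] A α} {L : G → U →ₗ[ℂ] ℂ} {Y : U} {g : Uˣ}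

theorem map_comul_mul_comul (hπ : IsQuotientFamily π)
    (hY : IsCointegralLift (π 0) (L 0) Y) {α β : G} (h : α + β = 0) (x : U) :
    Algebra.TensorProduct.map (π α) (π β) (comul (R := ℂ) x * comul Y) =
      counit (R := ℂ) x • Algebra.TensorProduct.map (π α) (π β) (comul (R := ℂ) Y) := by
  have h0 := hπ.map_comul_eq_zero α β (x * Y - counit (R := ℂ) x • Y) (by
    rw [h, map_sub, map_smul, hY.left, sub_self])
  rwa [map_sub, map_smul, map_sub, map_smul, sub_eq_zero, Bialgebra.comul_mul] at h0

theorem map_comul_mul_comul_right (hπ : IsQuotientFamily π)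
    (hY : IsCointegralLift (π 0) (L 0) Y) {α β : G} (h : α + β = 0) (x : U) :
    Algebra.TensorProduct.map (π α) (π β) (comul (R := ℂ) Y * comul x) =
      counit (R := ℂ) x • Algebra.TensorProduct.map (π α) (π β) (comul (R := ℂ) Y) := by
  have h0 := hπ.map_comul_eq_zero α β (Y * x - counit (R := ℂ) x • Y) (by
    rw [h, map_sub, map_smul, hY.right, sub_self])
  rwa [map_sub, map_smul, map_sub, map_smul, sub_eq_zero, Bialgebra.comul_mul] at h0

theorem sum_counit_smul_map (φ : U →ₗ[ℂ] U) (x : U) :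
    ∑ i ∈ (ℛ ℂ x).index, counit (R := ℂ) ((ℛ ℂ x).left i) • φ ((ℛ ℂ x).right i) = φ x := by
  conv_rhs => rw [← sum_counit_smul (ℛ ℂ x)]
  simp

/-- Write x ⊗ 1 = ∑ (1 ⊗ S⁻¹(x₂)) Δ(x₁); then Δ(x₁) Δ(Y) = ε(x₁) Δ(Y) in A_α ⊗ A_β. -/
theorem map_tmul_one_mul_comul (hπ : IsQuotientFamily π) (hg : IsPivot g)
    (hY : IsCointegralLift (π 0) (L 0) Y) {α β : G} (h : α + β = 0) (x : U) :
    Algebra.TensorProduct.map (π α) (π β) ((x ⊗ₜ[ℂ] 1) * comul Y) =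
      Algebra.TensorProduct.map (π α) (π β) ((1 ⊗ₜ[ℂ] antipodeInv g x) * comul Y) := by
  rw [← hg.sum_antipodeInv_mul_comul x]
  conv_rhs => rw [← sum_counit_smul_map (antipodeInv g) x]
  simp only [Finset.sum_mul, map_sum, TensorProduct.tmul_sum]
  refine Finset.sum_congr rfl fun i _ => ?_
  rw [mul_assoc, map_mul, map_comul_mul_comul hπ hY h, TensorProduct.tmul_smul, smul_mul_assoc,
    map_smul, map_mul, mul_smul_comm]

theorem map_comul_mul_tmul_one (hπ : IsQuotientFamily π)
    (hY : IsCointegralLift (π 0) (L 0) Y) {α β : G} (h : α + β = 0) (x : U) :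
    Algebra.TensorProduct.map (π α) (π β) (comul Y * (x ⊗ₜ[ℂ] 1)) =
      Algebra.TensorProduct.map (π α) (π β) (comul Y * (1 ⊗ₜ[ℂ] antipode ℂ x)) := by
  rw [← sum_comul_mul_antipode x]
  conv_rhs => rw [← sum_counit_smul_map (antipode ℂ) x]
  simp only [Finset.mul_sum, map_sum, TensorProduct.tmul_sum]
  refine Finset.sum_congr rfl fun i _ => ?_
  rw [← mul_assoc, map_mul, map_comul_mul_comul_right hπ hY h, TensorProduct.tmul_smul,
    mul_smul_comm, map_smul, map_mul, smul_mul_assoc]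

theorem slice_comul_cointegral (hL : IsIntegralLift π L)
    (hY : IsCointegralLift (π 0) (L 0) Y) {α β : G} (h : α + β = 0) :
    slice (L α) (π β).toLinearMap (comul Y) = 1 := by
  rw [hL.slice_comul, h, hY.norm, one_smul]

theorem slice_tmul_one_mul_comul (hπ : IsQuotientFamily π) (hL : IsIntegralLift π L)
    (hg : IsPivot g) (hY : IsCointegralLift (π 0) (L 0) Y) {α β : G} (h : α + β = 0) (x : U) :
    slice (L α) (π β).toLinearMap ((x ⊗ₜ[ℂ] 1) * comul Y) = π β (antipodeInv g x) := by
  rw [slice_eq_of_map_eq hπ (hL.eq_zero α) (map_tmul_one_mul_comul hπ hg hY h x),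
    slice_one_tmul_mul, slice_comul_cointegral hL hY h, mul_one]

theorem slice_comul_mul_tmul_one (hπ : IsQuotientFamily π) (hL : IsIntegralLift π L)
    (hY : IsCointegralLift (π 0) (L 0) Y) {α β : G} (h : α + β = 0) (x : U) :
    slice (L α) (π β).toLinearMap (comul Y * (x ⊗ₜ[ℂ] 1)) = π β (antipode ℂ x) := by
  rw [slice_eq_of_map_eq hπ (hL.eq_zero α) (map_comul_mul_tmul_one hπ hY h x),
    slice_mul_one_tmul, slice_comul_cointegral hL hY h, one_mul]

/-- The map `p ↦ p(Y₁) Y₂` from the dual of `A_α` to `A_β`. -/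
def cointegralMap (π : ∀ α, U →ₐ[ℂ] A α) (Y : U) (α β : G) : Module.Dual ℂ (A α) →ₗ[ℂ] A β where
  toFun p := slice (p ∘ₗ (π α).toLinearMap) (π β).toLinearMap (comul Y)
  map_add' p q := by
    simp [slice, LinearMap.add_comp, TensorProduct.map_add_left]
  map_smul' c p := by
    simp [slice, LinearMap.smul_comp, TensorProduct.map_smul_left]

/-- The image of z is reached from the form x ↦ L_α(S(z) x), since L_α(S(z) Y₁) Y₂ = S⁻¹(S(z)). -/
theorem cointegralMap_surjective (hπ : IsQuotientFamily π) (hL : IsIntegralLift π L)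
    (hg : IsPivot g) (hY : IsCointegralLift (π 0) (L 0) Y) {α β : G} (h : α + β = 0) :
    Function.Surjective (cointegralMap π Y α β) := fun y => by
  obtain ⟨z, rfl⟩ := hπ.surjective β y
  obtain ⟨p, hp⟩ := exists_comp_eq (L α ∘ₗ LinearMap.mulLeft ℂ (antipode ℂ z)) (π α).toLinearMap
    (hπ.surjective α) (fun x hx => hL.eq_zero α _ (by
      rw [AlgHom.toLinearMap_apply] at hx
      rw [LinearMap.mulLeft_apply, map_mul, hx, mul_zero]))
  refine ⟨p, ?_⟩
  change slice (p ∘ₗ (π α).toLinearMap) (π β).toLinearMap (comul Y) = _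
  rw [← hp, ← slice_tmul_one_mul, slice_tmul_one_mul_comul hπ hL hg hY h, hg.antipodeInv_antipode]

/-- Surjectivity for (α, β) and for (β, α) bounds each dimension by the other, so the two are equal.
-/
theorem cointegralMap_injective (hπ : IsQuotientFamily π) (hL : IsIntegralLift π L)
    (hg : IsPivot g) (hY : IsCointegralLift (π 0) (L 0) Y) {α β : G} (h : α + β = 0) :
    Function.Injective (cointegralMap π Y α β) := by
  have := hπ.finite
  have h1 := LinearMap.finrank_le_finrank_of_surjective (cointegralMap_surjective hπ hL hg hY h)
  have h2 := LinearMap.finrank_le_finrank_of_surjective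
    (cointegralMap_surjective hπ hL hg hY ((add_comm β α).trans h))
  rw [Subspace.dual_finrank_eq] at h1 h2
  refine (LinearMap.injective_iff_surjective_of_finrank_eq_finrank ?_).2
    (cointegralMap_surjective hπ hL hg hY h)
  rw [Subspace.dual_finrank_eq]
  exact le_antisymm h2 h1

/-- A form on `A_α` is determined by its contraction with the coproduct of the cointegral. -/
theorem eq_of_slice_comul_eq (hπ : IsQuotientFamily π) (hL : IsIntegralLift π L)
    (hg : IsPivot g) (hY : IsCointegralLift (π 0) (L 0) Y) {α β : G} (h : α + β = 0)
    {f f' : U →ₗ[ℂ] ℂ} (hf : ∀ x, π α x = 0 → f x = 0) (hf' : ∀ x, π α x = 0 → f' x = 0)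
    (hs : slice f (π β).toLinearMap (comul Y) = slice f' (π β).toLinearMap (comul Y)) :
    f = f' := by
  obtain ⟨p, rfl⟩ := exists_comp_eq f (π α).toLinearMap (hπ.surjective α) hf
  obtain ⟨q, rfl⟩ := exists_comp_eq f' (π α).toLinearMap (hπ.surjective α) hf'
  rw [cointegralMap_injective hπ hL hg hY h (show cointegralMap π Y α β p = _ from hs)]

/-- Both sides, as forms in x, contract with Δ(Y) to S(y): one by S, the other by S⁻¹(S²(y)). -/
theorem integral_mul_comm (hπ : IsQuotientFamily π) (hL : IsIntegralLift π L)
    (hg : IsPivot g) (hY : IsCointegralLift (π 0) (L 0) Y) (α : G) (x y : U) :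
    L α (x * y) = L α (antipode ℂ (antipode ℂ y) * x) := by
  have h := eq_of_slice_comul_eq hπ hL hg hY (add_neg_cancel α)
    (f := L α ∘ₗ LinearMap.mulRight ℂ y)
    (f' := L α ∘ₗ LinearMap.mulLeft ℂ (antipode ℂ (antipode ℂ y)))
    (fun x hx => hL.eq_zero α _ (by rw [LinearMap.mulRight_apply, map_mul, hx, zero_mul]))
    (fun x hx => hL.eq_zero α _ (by rw [LinearMap.mulLeft_apply, map_mul, hx, mul_zero])) (by
      rw [← slice_mul_tmul_one, ← slice_tmul_one_mul,
        slice_comul_mul_tmul_one hπ hL hY (add_neg_cancel α),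
        slice_tmul_one_mul_comul hπ hL hg hY (add_neg_cancel α), hg.antipodeInv_antipode])
  exact LinearMap.congr_fun h x

/-- Uniqueness of the right integral of `A_0`. -/
theorem rightIntegral_unique (hπ : IsQuotientFamily π) (hL : IsIntegralLift π L)
    (hg : IsPivot g) (hY : IsCointegralLift (π 0) (L 0) Y) {f : U →ₗ[ℂ] ℂ}
    (hf : ∀ x, π 0 x = 0 → f x = 0)
    (hint : ∀ x, slice f (π 0).toLinearMap (comul x) = f x • 1) : f = f Y • L 0 := by
  refine eq_of_slice_comul_eq hπ hL hg hY (add_zero 0) hf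
    (fun x hx => by rw [LinearMap.smul_apply, hL.eq_zero 0 x hx, smul_zero]) ?_
  have h1 : slice (f Y • L 0) (π 0).toLinearMap (comul Y) =
      f Y • slice (L 0) (π 0).toLinearMap (comul Y) := by
    simp [slice, TensorProduct.map_smul_left]
  rw [hint, h1, slice_comul_cointegral hL hY (add_zero 0)]

theorem slice_coassoc (q f : U →ₗ[ℂ] ℂ) {M : Type*} [AddCommGroup M] [Module ℂ M]
    (φ : U →ₗ[ℂ] M) (y : U) :
    slice (slice q f ∘ₗ comul) φ (comul y) = slice q (slice f φ ∘ₗ comul) (comul y) := by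
  have hΘ : ∀ (t : U ⊗[ℂ] U) (c : U), slice q (slice f φ) (TensorProduct.assoc ℂ U U U (t ⊗ₜ c)) =
      slice q f t • φ c := fun t c => by
    induction t using TensorProduct.induction_on with
    | zero => simp
    | tmul a b => simp [smul_smul]
    | add s t hs ht => rw [TensorProduct.add_tmul, map_add, map_add, hs, ht, map_add, add_smul]
  have h := congrArg (slice q (slice f φ)) (coassoc_apply (R := ℂ) y)
  rw [← (ℛ ℂ y).eq] at h ⊢
  simpa [hΘ] using h

/-- The contraction `y ↦ y₁ L_β(y₂)` is proportional to `L_{α+β}`. -/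
theorem slice_comm_comul (hπ : IsQuotientFamily π) (hL : IsIntegralLift π L)
    (hg : IsPivot g) (hY : IsCointegralLift (π 0) (L 0) Y) (α β : G) (y : U) :
    slice (L β) (π α).toLinearMap (TensorProduct.comm ℂ U U (comul y)) =
      L (α + β) y •
        slice (L (-α)) (π α).toLinearMap (TensorProduct.comm ℂ U U (comul Y)) := by
  rw [← sub_eq_zero, ← Module.forall_dual_apply_eq_zero_iff ℂ]
  intro p
  set q : U →ₗ[ℂ] ℂ := p ∘ₗ (π α).toLinearMap with hq
  have hp : ∀ (f : U →ₗ[ℂ] ℂ) (t : U ⊗[ℂ] U),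
      p (slice f (π α).toLinearMap (TensorProduct.comm ℂ U U t)) = slice q f t := fun f t => by
    induction t using TensorProduct.induction_on with
    | zero => simp
    | tmul a b => simp [hq, mul_comm]
    | add s t hs ht => simp only [map_add, hs, ht]
  have hq0 : ∀ x, π α x = 0 → q x = 0 := fun x hx => by simp [hq, hx]
  -- For a form q on A_α the family y ↦ q(y₁) L_{γ-α}(y₂) is again a right integral, the index shift
  -- making M_{α+β} involve L_β. By uniqueness M_0 is a multiple of L_0, and contracting with
  -- A_{α+β} carries the same factor over to M_{α+β}.
  let M : G → U →ₗ[ℂ] ℂ := fun γ => slice q (L (γ - α)) ∘ₗ comul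
  have hM0 : ∀ γ x, π γ x = 0 → M γ x = 0 := fun γ x hx => by
    obtain ⟨f, hf⟩ := exists_comp_eq (L (γ - α)) (π (γ - α)).toLinearMap (hπ.surjective _)
      (hL.eq_zero _)
    have h1 := slice_eq_of_map_eq hπ hq0 (s := comul x) (t := 0)
      ((hπ.map_comul_eq_zero α (γ - α) x (by rwa [add_sub_cancel])).trans (map_zero _).symm)
    have h2 : ∀ t, slice q (L (γ - α)) t = f (slice q (π (γ - α)).toLinearMap t) := fun t => by
      rw [hf]
      induction t using TensorProduct.induction_on with
      | zero => simp
      | tmul a b => simp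
      | add s t hs ht => simp only [map_add, hs, ht]
    change slice q (L (γ - α)) (comul x) = 0
    rw [h2, h1, map_zero, map_zero]
  have hM : ∀ γ γ' x, slice (M γ) (π γ').toLinearMap (comul x) = M (γ + γ') x • 1 :=
    fun γ γ' x => by
    have h1 : slice (L (γ - α)) (π γ').toLinearMap ∘ₗ comul =
        LinearMap.toSpanSingleton ℂ (A γ') 1 ∘ₗ L (γ + γ' - α) := LinearMap.ext fun z => by
      simp [hL.slice_comul, sub_add_eq_add_sub]
    have h2 : ∀ t, slice q (LinearMap.toSpanSingleton ℂ (A γ') 1 ∘ₗ L (γ + γ' - α)) t =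
        slice q (L (γ + γ' - α)) t • (1 : A γ') := fun t => by
      induction t using TensorProduct.induction_on with
      | zero => simp
      | tmul a b => simp [smul_smul]
      | add s t hs ht => simp only [map_add, hs, ht, add_smul]
    simp only [M]
    rw [slice_coassoc, h1, h2]
    rfl
  have hM1 := rightIntegral_unique hπ hL hg hY (hM0 0) fun x => by
    rw [hM 0 0 x, add_zero]
  have hMγ : M (α + β) y = M 0 Y * L (α + β) y := by
    -- If A_{α+β} is the zero ring, both forms vanish and there is no unit to cancel.
    by_cases h1 : (1 : A (α + β)) = 0
    · have hy : π (α + β) y = 0 := by rw [← mul_one (π (α + β) y), h1, mul_zero]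
      rw [hM0 _ y hy, hL.eq_zero _ y hy, mul_zero]
    · refine smul_left_injective ℂ h1 ?_
      have h2 := hM 0 (α + β) y
      have h3 : slice (M 0 Y • L 0) (π (α + β)).toLinearMap (comul y) =
          M 0 Y • slice (L 0) (π (α + β)).toLinearMap (comul y) := by
        simp [slice, TensorProduct.map_smul_left]
      rw [hM1, h3, hL.slice_comul, zero_add, smul_smul] at h2
      exact h2.symm
  rw [map_sub, map_smul, hp, hp, sub_eq_zero, smul_eq_mul, mul_comm]
  simpa [M] using hMγ

/-- The product formula for the contraction of the coproduct of the cointegral. -/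
theorem slice_mul_comul_mul (hπ : IsQuotientFamily π) (hL : IsIntegralLift π L)
    (hg : IsPivot g) (hY : IsCointegralLift (π 0) (L 0) Y) {α β : G} (h : α + β = 0)
    (s t : U ⊗[ℂ] U) :
    slice (L α) (π β).toLinearMap (s * comul Y * t) =
      π β (mulAntipodeInv g s * antipodeMul t) := by
  induction s using TensorProduct.induction_on with
  | zero => simp
  | add s s' hs hs' => rw [add_mul, add_mul, map_add, hs, hs', map_add, add_mul, map_add]
  | tmul x y =>
    induction t using TensorProduct.induction_on with
    | zero => simp
    | add s s' hs hs' => rw [mul_add, map_add, hs, hs', map_add, mul_add, map_add]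
    | tmul x' y' =>
      have e : (x ⊗ₜ[ℂ] y) * comul (R := ℂ) Y * (x' ⊗ₜ[ℂ] y') =
          (1 ⊗ₜ y) * ((x ⊗ₜ[ℂ] 1) * comul Y * (x' ⊗ₜ 1)) * (1 ⊗ₜ y') := by
        have e1 : (x ⊗ₜ[ℂ] y) = (1 ⊗ₜ y) * (x ⊗ₜ[ℂ] 1) := by simp
        have e2 : (x' ⊗ₜ[ℂ] y') = (x' ⊗ₜ 1) * (1 ⊗ₜ[ℂ] y') := by simp
        rw [e1, e2]
        simp only [mul_assoc]
      -- Moving x' around the integral replaces L_α(x Y₁ x') by L_α(S²(x') x Y₁), which contracts to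
      -- S⁻¹(x) S(x').
      have hz : L α ∘ₗ LinearMap.mulRight ℂ x' =
          L α ∘ₗ LinearMap.mulLeft ℂ (antipode ℂ (antipode ℂ x')) :=
        LinearMap.ext fun z => integral_mul_comm hπ hL hg hY α z x'
      rw [e, slice_mul_one_tmul, slice_one_tmul_mul, slice_mul_tmul_one, hz,
        ← slice_tmul_one_mul, ← mul_assoc, Algebra.TensorProduct.tmul_mul_tmul, one_mul,
        slice_tmul_one_mul_comul hπ hL hg hY h, antipodeInv_mul, hg.antipodeInv_antipode,
        mulAntipodeInv_tmul, antipodeMul_tmul]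
      simp only [map_mul, mul_assoc]

end Integrals

/-! ### The distinguished element of a graded family with quasi R-matrix -/

section Distinguished

variable {Λ : Type*} [AddCommGroup Λ] [DecidableEq Λ] {U : Type*} [Ring U] [HopfAlgebra ℂ U]
variable {𝒰 : Λ → Submodule ℂ U} [GradedAlgebra 𝒰]
variable {G : Type*} [AddCommGroup G] {A : G → Type*} [∀ α, Ring (A α)] [∀ α, Algebra ℂ (A α)]
variable {π : ∀ α, U →ₐ[ℂ] A α} {L : G → U →ₗ[ℂ] ℂ} {Y : U} {g : Uˣ}

/-- This is the degree l part of the integral identity: since Δx has total degree l, selecting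
degree l in the second leg selects degree 0 in the first. -/
theorem slice_comp_proj_comul (h𝒰 : IsGradedHopf 𝒰) (hL : IsIntegralLift π L)
    (hhom : ∀ α x, π α x = 0 → ∀ l, π α (GradedAlgebra.proj 𝒰 l x) = 0) (α β : G) {l : Λ} {x : U}
    (hx : x ∈ 𝒰 l) :
    slice (L α ∘ₗ GradedAlgebra.proj 𝒰 0) (π β).toLinearMap (comul x) =
      L (α + β) x • π β (GradedAlgebra.proj 𝒰 l 1) := by
  obtain ⟨ι, _, a, c, m, n, ha, hc, hmn, hsum⟩ := exists_homogeneous_sum (h𝒰.comul_mem l x hx)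
  have h1 := hL.slice_comul α β x
  rw [hsum, map_sum] at h1 ⊢
  have h2 : π β (∑ i, L α (a i) • c i - L (α + β) x • 1) = 0 := by
    rw [map_sub, map_sum, map_smul, map_one, sub_eq_zero, ← h1]
    simp
  have h3 := hhom β _ h2 l
  rw [map_sub, map_sub, sub_eq_zero, map_smul, map_smul, map_sum, map_sum] at h3
  rw [← h3]
  refine Finset.sum_congr rfl fun i _ => ?_
  rw [slice_tmul, map_smul, map_smul, LinearMap.comp_apply]
  by_cases hm : m i = 0
  · have hn : n i = l := by rw [← hmn i, hm, zero_add]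
    rw [proj_of_mem (hm ▸ ha i), proj_of_mem (hn ▸ hc i)]
    rfl
  · have hn : n i ≠ l := fun h => hm (by have := hmn i; rwa [h, add_eq_right] at this)
    rw [proj_of_mem_ne hm (ha i), proj_of_mem_ne hn (hc i), map_zero, map_zero, zero_smul,
      smul_zero]

/-- The form L_0 ∘ pr_0 is again a right integral, hence a multiple of L_0; evaluation at t shows
that the factor is 1. -/
theorem integral_comp_proj (h𝒰 : IsGradedHopf 𝒰) (hπ : IsQuotientFamily π)
    (hL : IsIntegralLift π L) (hg : IsPivot g) (hY : IsCointegralLift (π 0) (L 0) Y)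
    (hhom : ∀ α x, π α x = 0 → ∀ l, π α (GradedAlgebra.proj 𝒰 l x) = 0) {t : U} (ht : t ∈ 𝒰 0)
    (ht0 : L 0 t ≠ 0) : L 0 ∘ₗ GradedAlgebra.proj 𝒰 0 = L 0 := by
  have h1 := rightIntegral_unique hπ hL hg hY (f := L 0 ∘ₗ GradedAlgebra.proj 𝒰 0)
    (fun x hx => hL.eq_zero 0 _ (hhom 0 x hx 0)) (fun x => by
      have : slice (L 0 ∘ₗ GradedAlgebra.proj 𝒰 0) (π 0).toLinearMap ∘ₗ comul =
          LinearMap.toSpanSingleton ℂ (A 0) 1 ∘ₗ L 0 ∘ₗ GradedAlgebra.proj 𝒰 0 := by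
        refine linearMap_ext_homogeneous 𝒰 fun l x hx => ?_
        rw [LinearMap.comp_apply, slice_comp_proj_comul h𝒰 hL hhom 0 0 hx, add_zero]
        by_cases hl : l = 0
        · subst hl
          simp [proj_of_mem hx, proj_of_mem (SetLike.GradedOne.one_mem (A := 𝒰))]
        · simp [proj_of_mem_ne hl hx,
            proj_of_mem_ne (Ne.symm hl) (SetLike.GradedOne.one_mem (A := 𝒰))]
      exact LinearMap.congr_fun this x)
  have h2 := LinearMap.congr_fun h1 t
  rw [LinearMap.comp_apply, proj_of_mem ht, LinearMap.smul_apply, smul_eq_mul] at h2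
  rw [h1, (mul_eq_right₀ ht0).1 h2.symm, one_smul]

/-- Since L_0 ignores nonzero degrees, L_α(x) · 1 = L_0(x₁) x₂ equals L_α(x) times the degree l part
of 1, which is 0. -/
theorem integral_eq_zero_of_mem (h𝒰 : IsGradedHopf 𝒰) (hπ : IsQuotientFamily π)
    (hL : IsIntegralLift π L) (hg : IsPivot g) (hY : IsCointegralLift (π 0) (L 0) Y)
    (hhom : ∀ α x, π α x = 0 → ∀ l, π α (GradedAlgebra.proj 𝒰 l x) = 0) {t : U} (ht : t ∈ 𝒰 0)
    (ht0 : L 0 t ≠ 0) (α : G) {l : Λ} (hl : l ≠ 0) {x : U} (hx : x ∈ 𝒰 l) : L α x = 0 := by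
  have h1 := slice_comp_proj_comul h𝒰 hL hhom 0 α hx
  rw [integral_comp_proj h𝒰 hπ hL hg hY hhom ht ht0, hL.slice_comul,
    proj_of_mem_ne (Ne.symm hl) (SetLike.GradedOne.one_mem (A := 𝒰)), map_zero, smul_zero,
    zero_add, smul_eq_zero] at h1
  rcases h1 with h1 | h1
  · exact h1
  · exact hL.eq_zero α x (by rw [← mul_one (π α x), h1, mul_zero])

theorem proj_mul_of_left_mem {l : Λ} {x : U} (hx : x ∈ 𝒰 l) (y : U) :
    GradedAlgebra.proj 𝒰 l (x * y) = x * GradedAlgebra.proj 𝒰 0 y := by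
  have := DirectSum.coe_decompose_mul_add_of_left_mem 𝒰 (j := 0) (b := y) hx
  rwa [add_zero] at this

theorem proj_mul_of_right_mem {l : Λ} {x : U} (hx : x ∈ 𝒰 l) (y : U) :
    GradedAlgebra.proj 𝒰 l (y * x) = GradedAlgebra.proj 𝒰 0 y * x := by
  have := DirectSum.coe_decompose_mul_add_of_right_mem 𝒰 (i := 0) (a := y) hx
  rwa [zero_add] at this

theorem IsCointegralLift.proj_zero (h𝒰 : IsGradedHopf 𝒰)
    (hY : IsCointegralLift (π 0) (L 0) Y)
    (hhom : ∀ x, π 0 x = 0 → ∀ l, π 0 (GradedAlgebra.proj 𝒰 l x) = 0)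
    (h0 : L 0 ∘ₗ GradedAlgebra.proj 𝒰 0 = L 0) :
    IsCointegralLift (π 0) (L 0) (GradedAlgebra.proj 𝒰 0 Y) := by
  have hε : ∀ l, ∀ x ∈ 𝒰 l, counit (R := ℂ) x • GradedAlgebra.proj 𝒰 l Y =
      counit (R := ℂ) x • GradedAlgebra.proj 𝒰 0 Y := fun l x hx => by
    by_cases hl : l = 0
    · rw [hl]
    · rw [h𝒰.counit_eq_zero l hl x hx, zero_smul, zero_smul]
  refine ⟨fun x => ?_, fun x => ?_, ?_⟩
  · have h : (π 0).toLinearMap ∘ₗ LinearMap.mulRight ℂ (GradedAlgebra.proj 𝒰 0 Y) =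
        LinearMap.toSpanSingleton ℂ (A 0) (π 0 (GradedAlgebra.proj 𝒰 0 Y)) ∘ₗ counit := by
      refine linearMap_ext_homogeneous 𝒰 fun l x hx => ?_
      have h1 := hhom (x * Y - counit (R := ℂ) x • Y) (by
        rw [map_sub, map_smul, hY.left, sub_self]) l
      rw [map_sub, map_smul, proj_mul_of_left_mem hx, hε l x hx, map_sub, sub_eq_zero,
        map_smul] at h1
      exact h1
    exact LinearMap.congr_fun h x
  · have h : (π 0).toLinearMap ∘ₗ LinearMap.mulLeft ℂ (GradedAlgebra.proj 𝒰 0 Y) =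
        LinearMap.toSpanSingleton ℂ (A 0) (π 0 (GradedAlgebra.proj 𝒰 0 Y)) ∘ₗ counit := by
      refine linearMap_ext_homogeneous 𝒰 fun l x hx => ?_
      have h1 := hhom (Y * x - counit (R := ℂ) x • Y) (by
        rw [map_sub, map_smul, hY.right, sub_self]) l
      rw [map_sub, map_smul, proj_mul_of_right_mem hx, hε l x hx, map_sub, sub_eq_zero,
        map_smul] at h1
      exact h1
    exact LinearMap.congr_fun h x
  · rw [← LinearMap.comp_apply, h0, hY.norm]

variable {K : DualGroupAlgebra Λ →ₐc[ℂ] U} {B : Λ →ₗ[ℤ] Λ →ₗ[ℤ] ℤ} {Rc : (U ⊗[ℂ] U)ˣ}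
  {h𝒰 : IsGradedHopf 𝒰}

/-- Only terms with first leg in degree 0 survive f. Their second leg then has degree 0 as well, so
the twisting factors are 1. -/
theorem slice_cartanTwist (hK : ∀ a, Kel K a ∈ 𝒰 0) {f : U →ₗ[ℂ] ℂ}
    (hf : ∀ l, l ≠ 0 → ∀ x ∈ 𝒰 l, f x = 0) {M : Type*} [AddCommGroup M] [Module ℂ M]
    (φ : U →ₗ[ℂ] M) {t : U ⊗[ℂ] U} (ht : t ∈ totalDegree 𝒰 0) :
    slice f φ (cartanTwist 𝒰 K B t) = slice f φ t := by
  obtain ⟨ι, _, x, y, n, hx, hy, rfl⟩ := exists_balanced_sum ht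
  simp only [map_sum]
  refine Finset.sum_congr rfl fun i _ => ?_
  rw [cartanTwist_tmul 𝒰 K B (hx i) (hy i), slice_tmul, slice_tmul]
  by_cases hn : n i = 0
  · simp [hn, Kel_zero]
  · rw [hf _ hn _ (hx i), hf (n i) hn _ (by simpa using SetLike.GradedMul.mul_mem (hx i) (hK _)),
      zero_smul, zero_smul]

theorem IsQuasiRMatrix.inv_mem_totalDegree (hR : IsQuasiRMatrix 𝒰 h𝒰 K g B Rc)
    (hK : ∀ a, Kel K a ∈ 𝒰 0) (hT : (Rc : U ⊗[ℂ] U) ∈ totalDegree 𝒰 0) :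
    ((Rc⁻¹ : (U ⊗[ℂ] U)ˣ) : U ⊗[ℂ] U) ∈ totalDegree 𝒰 0 := by
  obtain ⟨ι, _, x, y, n, hx, hy, hsum⟩ := exists_balanced_sum hT
  rw [hR.inv_eq_sum hy hsum]
  refine Submodule.sum_mem _ fun i _ => tmul_mem_totalDegree (add_neg_cancel (n i)) ?_ (hy i)
  simpa using SetLike.GradedMul.mul_mem (h𝒰.antipode_mem _ _ (hx i)) (hK (B (n i)))

/-- The contraction `y ↦ y₁ L_β(y₂)` is `L_{α+β}(y) g²`. -/
theorem slice_comm_comul_eq_pivot_sq [IsAddTorsionFree Λ] (hπ : IsQuotientFamily π)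
    (hL : IsIntegralLift π L) (hg : IsPivot g) (hY : IsCointegralLift (π 0) (L 0) Y)
    (hhom : ∀ α x, π α x = 0 → ∀ l, π α (GradedAlgebra.proj 𝒰 l x) = 0) {t : U} (ht : t ∈ 𝒰 0)
    (ht0 : L 0 t ≠ 0) (hR : IsQuasiRMatrix 𝒰 h𝒰 K g B Rc) (hK : ∀ a, Kel K a ∈ 𝒰 0)
    (hKc : ∀ a, ∀ x ∈ 𝒰 0, Commute (Kel K a) x)
    (hT : (Rc : U ⊗[ℂ] U) ∈ totalDegree 𝒰 0) (α β : G) (y : U) :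
    slice (L β) (π α).toLinearMap (TensorProduct.comm ℂ U U (comul y)) =
      L (α + β) y • π α g ^ 2 := by
  have hY0 := hY.proj_zero h𝒰 (hhom 0) (integral_comp_proj h𝒰 hπ hL hg hY hhom ht ht0)
  have hw : (Rc : U ⊗[ℂ] U) * comul (GradedAlgebra.proj 𝒰 0 Y) *
      ((Rc⁻¹ : (U ⊗[ℂ] U)ˣ) : U ⊗[ℂ] U) ∈ totalDegree 𝒰 0 := by
    simpa using mul_mem_totalDegree (mul_mem_totalDegree hT
      (h𝒰.comul_mem 0 _ (proj_mem 0 Y))) (hR.inv_mem_totalDegree hK hT)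
  -- The proportionality factor is computed with the degree 0 part of Y, so that the Cartan twist
  -- disappears.
  rw [slice_comm_comul hπ hL hg hY0, hR.comm_comul, slice_cartanTwist hK
    (fun l hl x hx => integral_eq_zero_of_mem h𝒰 hπ hL hg hY hhom ht ht0 (-α) hl hx) _ hw,
    slice_mul_comul_mul hπ hL hg hY0 (neg_add_cancel α),
    hR.mulAntipodeInv_mul_antipodeMul_inv hg hK hKc hT, map_pow]

end Distinguished

/-! ### The quotients `𝒰_α` -/

section Quotients

variable {Λ : Type*} [AddCommGroup Λ] {U : Type*} [Ring U] [HopfAlgebra ℂ U]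

/-! ### The Cartan part of a pivotal extension -/

section PivotalExtension

variable {ℓ : ℕ} [DecidableEq Λ] {W : Type*} [AddCommGroup W] [Module ℂ W]
  {𝒲 : Λ → Submodule ℂ W} {oneW : W} {𝒰 : Λ → Submodule ℂ U}
  {j : W →ₗ[ℂ] U} {K : DualGroupAlgebra Λ →ₐc[ℂ] U} {g : Uˣ}

omit [DecidableEq Λ] in
theorem IsPivotalExtension.Kel_mem (hU : IsPivotalExtension ℓ 𝒲 oneW 𝒰 j K g)
    (a : Module.Dual ℤ Λ) : Kel K a ∈ 𝒰 0 := by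
  rw [← one_mul (Kel K a), ← hU.map_oneW]
  exact hU.mul_mem 0 oneW hU.oneW_mem (AddMonoidAlgebra.single a 1)

theorem IsPivotalExtension.linearMap_ext [DirectSum.Decomposition 𝒲]
    (hU : IsPivotalExtension ℓ 𝒲 oneW 𝒰 j K g) {M : Type*} [AddCommGroup M] [Module ℂ M]
    {f f' : U →ₗ[ℂ] M}
    (h : ∀ l, ∀ w ∈ 𝒲 l, ∀ p : DualGroupAlgebra Λ, f (j w * K p) = f' (j w * K p)) : f = f' := by
  have h1 : f ∘ₗ TensorProduct.lift
      ((LinearMap.mul ℂ U).compl₁₂ j (K : DualGroupAlgebra Λ →ₗ[ℂ] U)) =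
      f' ∘ₗ TensorProduct.lift
      ((LinearMap.mul ℂ U).compl₁₂ j (K : DualGroupAlgebra Λ →ₗ[ℂ] U)) := by
    refine TensorProduct.ext' fun w p => ?_
    change f (j w * K p) = f' (j w * K p)
    induction w using DirectSum.Decomposition.inductionOn 𝒲 with
    | zero => simp
    | add w w' hw hw' => rw [map_add, add_mul, map_add, map_add, hw, hw']
    | homogeneous w => exact h _ _ w.2 p
  refine LinearMap.ext fun x => ?_
  obtain ⟨t, rfl⟩ := hU.bijective.2 x
  exact LinearMap.congr_fun h1 t

/-- Degree 0 is spanned by products w p with w of degree 0 and p in ℂ[Λ*]; the commutation factor on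
w is ξ^{a(0)} = 1. -/
theorem IsPivotalExtension.commute_Kel [DirectSum.Decomposition 𝒲] [GradedAlgebra 𝒰]
    (hU : IsPivotalExtension ℓ 𝒲 oneW 𝒰 j K g) (a : Module.Dual ℤ Λ) {x : U} (hx : x ∈ 𝒰 0) :
    Commute (Kel K a) x := by
  have h : LinearMap.mulLeft ℂ (Kel K a) ∘ₗ GradedAlgebra.proj 𝒰 0 =
      LinearMap.mulRight ℂ (Kel K a) ∘ₗ GradedAlgebra.proj 𝒰 0 := by
    refine hU.linearMap_ext fun l w hw p => ?_
    simp only [LinearMap.comp_apply, LinearMap.mulLeft_apply, LinearMap.mulRight_apply]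
    by_cases hl : l = 0
    · subst hl
      have h1 := congrArg (· * Kel K a) (hU.conj a 0 w hw)
      simp only [mul_assoc, ← Kel_add, neg_add_cancel, Kel_zero, mul_one, map_zero, zpow_zero,
        one_smul] at h1
      have h2 : K p * Kel K a = Kel K a * K p := by
        rw [Kel, ← map_mul, mul_comm, map_mul]
      rw [proj_of_mem (hU.mul_mem 0 w hw p), ← mul_assoc, h1, mul_assoc, mul_assoc, h2]
    · rw [proj_of_mem_ne hl (hU.mul_mem l w hw p), mul_zero, zero_mul]
  have h1 := LinearMap.congr_fun h x
  simp only [LinearMap.comp_apply, proj_of_mem hx] at h1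
  exact h1

end PivotalExtension

/-! ### Homogeneity and finite dimension of the quotients -/

variable {ℓ r : ℕ} {b : Module.Basis (Fin r) ℤ Λ} {K : DualGroupAlgebra Λ →ₐc[ℂ] U}

theorem Ubar.proj_surjective (α : GroupG r) : Function.Surjective (Ubar.proj ℓ b K α) :=
  RingQuot.mkAlgHom_surjective ℂ _

theorem Ubar.comul_proj [NeZero ℓ] (α β : GroupG r) (x : U) :
    Ubar.comul ℓ b K α β (Ubar.proj ℓ b K (α + β) x) =
      Algebra.TensorProduct.map (Ubar.proj ℓ b K α) (Ubar.proj ℓ b K β)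
        (Coalgebra.comul (R := ℂ) x) :=
  RingQuot.liftAlgHom_mkAlgHom_apply ℂ _ _ x

theorem Ubar.counit_proj [NeZero ℓ] (x : U) :
    Ubar.counit ℓ b K (Ubar.proj ℓ b K 0 x) = Coalgebra.counit (R := ℂ) x :=
  RingQuot.liftAlgHom_mkAlgHom_apply ℂ _ _ x

/-- The ideal is generated by elements of degree 0, hence homogeneous. Concretely, x ↦ ∑ π(x_l) T^l
is an algebra morphism that respects the defining relations, so it factors through the quotient. -/
theorem Ubar.proj_proj_eq_zero [DecidableEq Λ] {𝒰 : Λ → Submodule ℂ U} [GradedAlgebra 𝒰]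
    (hK : ∀ a, Kel K a ∈ 𝒰 0) (α : GroupG r) {x : U} (hx : Ubar.proj ℓ b K α x = 0) (l : Λ) :
    Ubar.proj ℓ b K α (GradedAlgebra.proj 𝒰 l x) = 0 := by
  let A := Ubar ℓ b K α
  let π := Ubar.proj ℓ b K α
  let σ : Λ → A →ₗ[ℂ] AddMonoidAlgebra A Λ := fun l =>
    { toFun := fun x => AddMonoidAlgebra.single l x
      map_add' := fun x y => by simp
      map_smul' := fun c x => by simp }
  let γ : U →ₗ[ℂ] AddMonoidAlgebra A Λ := byDegree 𝒰 fun l => σ l ∘ₗ π.toLinearMap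
  have hγ : ∀ {l : Λ} {x : U}, x ∈ 𝒰 l → γ x = AddMonoidAlgebra.single l (π x) := fun h => by
    simp only [γ]; rw [byDegree_of_mem 𝒰 _ h]; rfl
  let Γ : U →ₐ[ℂ] AddMonoidAlgebra A Λ := AlgHom.ofLinearMap γ
    (by rw [hγ (SetLike.GradedOne.one_mem (A := 𝒰)), map_one, AddMonoidAlgebra.one_def])
    (fun x y => by
      induction x using DirectSum.Decomposition.inductionOn 𝒰 with
      | zero => simp
      | add x x' hx hx' => rw [add_mul, map_add, hx, hx', map_add, add_mul]
      | @homogeneous l x =>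
        induction y using DirectSum.Decomposition.inductionOn 𝒰 with
        | zero => simp
        | add y y' hy hy' => rw [mul_add, map_add, hy, hy', map_add, mul_add]
        | @homogeneous m y =>
          rw [hγ x.2, hγ y.2, hγ (SetLike.GradedMul.mul_mem x.2 y.2), map_mul,
            AddMonoidAlgebra.single_mul_single])
  let Γ' : A →ₐ[ℂ] AddMonoidAlgebra A Λ := RingQuot.liftAlgHom ℂ ⟨Γ, by
    rintro _ _ ⟨i, z, hz⟩
    have h1 : Γ (Kel K (b.coord i)) = AddMonoidAlgebra.single 0 (π (Kel K (b.coord i))) :=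
      hγ (hK _)
    rw [map_pow, h1, AddMonoidAlgebra.single_pow, nsmul_zero, AlgHom.commutes]
    simp only [π]
    rw [Ubar.proj_Kel_pow ℓ b K α i z hz]
    rfl⟩
  have hΓ' : ∀ y, Γ' (π y) = γ y := fun y => RingQuot.liftAlgHom_mkAlgHom_apply ℂ _ _ y
  have hcoeff : ∀ y, (γ y).coeff l = π (GradedAlgebra.proj 𝒰 l y) := fun y => by
    induction y using DirectSum.Decomposition.inductionOn 𝒰 with
    | zero => simp
    | add x y hx hy => simp [hx, hy]
    | @homogeneous m y =>
      rw [hγ y.2]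
      by_cases h : m = l
      · subst h; simp [proj_of_mem y.2]
      · simp [proj_of_mem_ne h y.2, h]
  have h0 : γ x = 0 := by rw [← hΓ', show π x = 0 from hx, map_zero]
  change π _ = 0
  rw [← hcoeff, h0]
  simp

theorem Kel_nsmul (n : ℕ) (a : Module.Dual ℤ Λ) : Kel K (n • a) = Kel K a ^ n := by
  induction n with
  | zero => rw [zero_smul, Kel_zero, pow_zero]
  | succ n ih => rw [succ_nsmul, Kel_add, ih, pow_succ]

/-- The elements `a ∈ Λ*` such that `K^a` is a nonzero scalar in `𝒰_α`. -/
def scalarSubgroup (ℓ : ℕ) (b : Module.Basis (Fin r) ℤ Λ) (K : DualGroupAlgebra Λ →ₐc[ℂ] U)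
    (α : GroupG r) : AddSubgroup (Module.Dual ℤ Λ) where
  carrier := {a | ∃ c : ℂ, c ≠ 0 ∧ Ubar.proj ℓ b K α (Kel K a) = algebraMap ℂ _ c}
  zero_mem' := ⟨1, one_ne_zero, by rw [Kel_zero, map_one, map_one]⟩
  add_mem' := by
    rintro a a' ⟨c, hc, h⟩ ⟨c', hc', h'⟩
    exact ⟨c * c', mul_ne_zero hc hc', by rw [Kel_add, map_mul, map_mul, h, h']⟩
  neg_mem' := by
    rintro a ⟨c, hc, h⟩
    refine ⟨c⁻¹, inv_ne_zero hc, ?_⟩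
    have h1 : Ubar.proj ℓ b K α (Kel K (-a)) * Ubar.proj ℓ b K α (Kel K a) = 1 := by
      rw [← map_mul, ← Kel_add, neg_add_cancel, Kel_zero, map_one]
    rw [h] at h1
    have h2 := congrArg (· * algebraMap ℂ (Ubar ℓ b K α) c⁻¹) h1
    simpa only [mul_assoc, ← map_mul, mul_inv_cancel₀ hc, map_one, mul_one, one_mul] using h2

theorem smul_coord_mem_scalarSubgroup (α : GroupG r) (i : Fin r) :
    ℓ • b.coord i ∈ scalarSubgroup ℓ b K α := by
  obtain ⟨z, hz⟩ := QuotientAddGroup.mk_surjective (α i)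
  exact ⟨_, Complex.exp_ne_zero _, by
    rw [Kel_nsmul, map_pow]; exact Ubar.proj_Kel_pow ℓ b K α i z hz⟩

theorem Ubar.proj_Kel_mem_span [NeZero ℓ] (α : GroupG r) (a : Module.Dual ℤ Λ) :
    Ubar.proj ℓ b K α (Kel K a) ∈ Submodule.span ℂ (Set.range fun k : Fin r → Fin ℓ =>
      Ubar.proj ℓ b K α (Kel K (dualPoint b k))) := by
  have hl : (ℓ : ℤ) ≠ 0 := Int.natCast_ne_zero.2 (NeZero.ne ℓ)
  have hl' : (0 : ℤ) < ℓ := by have := NeZero.pos ℓ; exact_mod_cast this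
  let k : Fin r → Fin ℓ := fun i => ⟨(a (b i) % ℓ).toNat, by
    have h1 := Int.emod_lt_of_pos (a (b i)) hl'
    have h2 := Int.emod_nonneg (a (b i)) hl
    omega⟩
  have hk : ∀ i, ((k i : ℕ) : ℤ) = a (b i) % ℓ := fun i =>
    Int.toNat_of_nonneg (Int.emod_nonneg _ hl)
  -- Division with remainder by ℓ in each coordinate; the quotient part acts by a scalar in 𝒰_α.
  have ha : a = ∑ i, (a (b i) / ℓ) • (ℓ • b.coord i) + dualPoint b k := by
    refine b.ext fun m => ?_
    have h1 := Int.mul_ediv_add_emod (a (b m)) ℓ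
    simp only [dualPoint, hk, LinearMap.add_apply, LinearMap.sum_apply, LinearMap.smul_apply,
      Module.Basis.coord_apply, Module.Basis.repr_self, Finsupp.single_apply, smul_eq_mul,
      mul_ite, mul_one, mul_zero, nsmul_eq_mul, Finset.sum_ite_eq, Finset.mem_univ, if_true]
    rw [mul_comm, h1]
  obtain ⟨c, _, hc⟩ := (scalarSubgroup ℓ b K α).sum_mem (t := Finset.univ) fun i _ =>
    (scalarSubgroup ℓ b K α).zsmul_mem (smul_coord_mem_scalarSubgroup α i) (a (b i) / ℓ)
  rw [ha, Kel_add, map_mul, hc, ← Algebra.smul_def]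
  exact Submodule.smul_mem _ _ (Submodule.subset_span ⟨k, rfl⟩)

theorem Ubar.finiteDimensional [NeZero ℓ] {W : Type*} [AddCommGroup W] [Module ℂ W]
    [FiniteDimensional ℂ W] {j : W →ₗ[ℂ] U}
    (hj : Function.Surjective
      (TensorProduct.lift ((LinearMap.mul ℂ U).compl₁₂ j (K : DualGroupAlgebra Λ →ₗ[ℂ] U))))
    (α : GroupG r) : FiniteDimensional ℂ (Ubar ℓ b K α) := by
  set V := Submodule.span ℂ (Set.range fun k : Fin r → Fin ℓ =>
      Ubar.proj ℓ b K α (Kel K (dualPoint b k))) with hV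
  have : FiniteDimensional ℂ V := FiniteDimensional.span_of_finite ℂ (Set.finite_range _)
  have hp : ∀ p, Ubar.proj ℓ b K α (K p) ∈ V := fun p => by
    induction p using AddMonoidAlgebra.induction_linear with
    | zero => simp
    | add p q hp hq => rw [map_add, map_add]; exact V.add_mem hp hq
    | single a c =>
      have h1 : (AddMonoidAlgebra.single a c : DualGroupAlgebra Λ) =
          c • AddMonoidAlgebra.single a 1 := by simp
      rw [h1, map_smul, map_smul]
      exact V.smul_mem _ (Ubar.proj_Kel_mem_span α a)
  let F : W ⊗[ℂ] V →ₗ[ℂ] Ubar ℓ b K α := TensorProduct.lift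
    ((LinearMap.mul ℂ (Ubar ℓ b K α)).compl₁₂ ((Ubar.proj ℓ b K α).toLinearMap ∘ₗ j) V.subtype)
  refine Module.Finite.of_surjective F (LinearMap.range_eq_top.1 ?_)
  rw [eq_top_iff]
  rintro x -
  obtain ⟨y, rfl⟩ := Ubar.proj_surjective α x
  obtain ⟨t, rfl⟩ := hj y
  induction t using TensorProduct.induction_on with
  | zero => simp
  | tmul w p => exact ⟨w ⊗ₜ ⟨_, hp p⟩, (map_mul (Ubar.proj ℓ b K α) (j w) (K p)).symm⟩
  | add s t hs ht => rw [map_add, map_add]; exact Submodule.add_mem _ hs ht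

end Quotients

/-! ### The distinguished grouplike element of `𝒰_•` -/

section Main

variable {Λ : Type*} [AddCommGroup Λ] {U : Type*} [Ring U] [HopfAlgebra ℂ U]
variable {ℓ r : ℕ} {b : Module.Basis (Fin r) ℤ Λ} {K : DualGroupAlgebra Λ →ₐc[ℂ] U}

theorem Ubar.isQuotientFamily [NeZero ℓ] {W : Type*} [AddCommGroup W] [Module ℂ W]
    [FiniteDimensional ℂ W] {j : W →ₗ[ℂ] U}
    (hj : Function.Surjective
      (TensorProduct.lift ((LinearMap.mul ℂ U).compl₁₂ j (K : DualGroupAlgebra Λ →ₗ[ℂ] U)))) :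
    IsQuotientFamily (fun α : GroupG r => Ubar.proj ℓ b K α) where
  surjective := Ubar.proj_surjective
  map_comul_eq_zero α β x hx := by rw [← Ubar.comul_proj, hx, map_zero]
  finite := Ubar.finiteDimensional hj

theorem lid_rTensor_map {A A' : Type*} [Ring A] [Algebra ℂ A] [Ring A']
    [Algebra ℂ A'] (φ : U →ₐ[ℂ] A) (ψ : U →ₐ[ℂ] A') (p : A →ₗ[ℂ] ℂ) (t : U ⊗[ℂ] U) :
    TensorProduct.lid ℂ A' (p.rTensor A' (Algebra.TensorProduct.map φ ψ t)) =
      slice (p ∘ₗ φ.toLinearMap) ψ.toLinearMap t := by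
  induction t using TensorProduct.induction_on with
  | zero => simp
  | tmul x y => simp
  | add s t hs ht => simp only [map_add, hs, ht]

theorem rid_lTensor_map {A A' : Type*} [Ring A] [Algebra ℂ A] [Ring A']
    [Algebra ℂ A'] (φ : U →ₐ[ℂ] A) (ψ : U →ₐ[ℂ] A') (p : A' →ₗ[ℂ] ℂ) (t : U ⊗[ℂ] U) :
    TensorProduct.rid ℂ A (p.lTensor A (Algebra.TensorProduct.map φ ψ t)) =
      slice (p ∘ₗ ψ.toLinearMap) φ.toLinearMap (TensorProduct.comm ℂ U U t) := by
  induction t using TensorProduct.induction_on with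
  | zero => simp
  | tmul x y => simp
  | add s t hs ht => simp only [map_add, hs, ht]

theorem mul_rid_lTensor {A A' : Type*} [Ring A] [Algebra ℂ A] [Ring A'] [Algebra ℂ A']
    (p : A' →ₗ[ℂ] ℂ) (c : A) (c' : A') (t : A ⊗[ℂ] A') :
    c * TensorProduct.rid ℂ A ((p ∘ₗ LinearMap.mulLeft ℂ c').lTensor A t) =
      TensorProduct.rid ℂ A (p.lTensor A ((c ⊗ₜ c') * t)) := by
  induction t using TensorProduct.induction_on with
  | zero => simp
  | tmul x y => simp
  | add s t hs ht => simp only [map_add, mul_add, hs, ht]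

theorem isIntegralLift [NeZero ℓ] {lam : ∀ α : GroupG r, Ubar ℓ b K α →ₗ[ℂ] ℂ}
    (hlam : IsRightGIntegral (Ubar.comul ℓ b K) lam) :
    IsIntegralLift (fun α : GroupG r => Ubar.proj ℓ b K α)
      (fun α => lam α ∘ₗ (Ubar.proj ℓ b K α).toLinearMap) where
  eq_zero α x hx := by simp [hx]
  slice_comul α β x := by
    have h := hlam α β (Ubar.proj ℓ b K (α + β) x)
    rwa [Ubar.comul_proj, lid_rTensor_map] at h

theorem exists_isCointegralLift [NeZero ℓ] {Υ : Ubar ℓ b K (0 : GroupG r)}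
    (hΥ : IsTwoSidedCointegral (Ubar.counit ℓ b K) Υ) {f : Ubar ℓ b K (0 : GroupG r) →ₗ[ℂ] ℂ}
    (hnorm : f Υ = 1) : ∃ Y, Ubar.proj ℓ b K 0 Y = Υ ∧
      IsCointegralLift (A := fun α : GroupG r => Ubar ℓ b K α) (Ubar.proj ℓ b K 0)
        (f ∘ₗ (Ubar.proj ℓ b K 0).toLinearMap) Y := by
  obtain ⟨Y, rfl⟩ := Ubar.proj_surjective 0 Υ
  exact ⟨Y, rfl, fun x => by rw [map_mul, hΥ.left, Ubar.counit_proj],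
    fun x => by rw [map_mul, hΥ.right, Ubar.counit_proj], hnorm⟩

/-! ### A degree 0 lift of the twist -/

section Theta

variable [DecidableEq Λ] {𝒰 : Λ → Submodule ℂ U} [GradedAlgebra 𝒰]

omit [DecidableEq Λ] [GradedAlgebra 𝒰] in
theorem fourierH_mem_totalDegree (hK : ∀ a, Kel K a ∈ 𝒰 0) (B : Λ →ₗ[ℤ] Λ →ₗ[ℤ] ℤ) :
    fourierH ℓ b K B ∈ totalDegree 𝒰 0 :=
  Submodule.sum_mem _ fun _ _ => Submodule.sum_mem _ fun _ _ =>
    Submodule.smul_mem _ _ (tmul_mem_totalDegree (add_zero 0) (hK _) (hK _))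

theorem exists_lift_theta0 [IsAddTorsionFree Λ] (h𝒰 : IsGradedHopf 𝒰) {g : Uˣ} (hg : IsPivot g)
    (hK : ∀ a, Kel K a ∈ 𝒰 0) (B : Λ →ₗ[ℤ] Λ →ₗ[ℤ] ℤ) {R : U ⊗[ℂ] U}
    (hR : R ∈ totalDegree 𝒰 0) : ∃ t ∈ 𝒰 0, Ubar.proj ℓ b K 0 t = theta0 ℓ b K g B R := by
  refine ⟨_, ?_, rfl⟩
  have hg0 : ((g⁻¹ : Uˣ) : U) ∈ 𝒰 0 := by
    rw [← hg.antipode_coe]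
    exact h𝒰.antipode_mem 0 _ (h𝒰.groupLike_mem hg.grouplike)
  have hHR : fourierH ℓ b K B * R ∈ totalDegree 𝒰 0 := by
    simpa using mul_mem_totalDegree (fourierH_mem_totalDegree hK B) hR
  have hS : (antipode ℂ ∘ₗ antipode ℂ).rTensor U (fourierH ℓ b K B * R) ∈ totalDegree 𝒰 0 := by
    obtain ⟨ι, _, x, y, n, hx, hy, hsum⟩ := exists_balanced_sum hHR
    rw [hsum, map_sum]
    exact Submodule.sum_mem _ fun i _ => tmul_mem_totalDegree (add_neg_cancel (n i))
      (h𝒰.antipode_mem _ _ (h𝒰.antipode_mem _ _ (hx i))) (hy i)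
  simpa using SetLike.GradedMul.mul_mem hg0 (mul'_mem hS)

end Theta

theorem isGGrouplike_proj_pow [NeZero ℓ] {x : U} (hx : IsGroupLikeElem ℂ x) (n : ℕ) :
    IsGGrouplike (Ubar.comul ℓ b K) (Ubar.counit ℓ b K)
      (fun α : GroupG r => Ubar.proj ℓ b K α x ^ n) where
  comul_eq α β := by
    rw [map_pow, Ubar.comul_proj, hx.comul_eq_tmul_self, Algebra.TensorProduct.map_tmul,
      Algebra.TensorProduct.tmul_pow]
  counit_eq := by rw [map_pow, Ubar.counit_proj, hx.counit_eq_one, one_pow]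

end Main

end UnrolledHopf
end

theorem propositionP
    (ℓ : ℕ) [NeZero ℓ]
    -- the free abelian group `Λ` of rank `r`, with a basis
    {Λ : Type*} [AddCommGroup Λ] [DecidableEq Λ] {r : ℕ} (b : Module.Basis (Fin r) ℤ Λ)
    -- the finite-dimensional `Λ`-graded vector space `W` with its degree `0` element `1_W`
    {W : Type*} [AddCommGroup W] [Module ℂ W] [FiniteDimensional ℂ W]
    (𝒲 : Λ → Submodule ℂ W) [DirectSum.Decomposition 𝒲] (oneW : W)
    -- the `Λ`-graded pivotal Hopf algebra `U = W ⊗ ℂ[Λ*]`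
    {U : Type*} [Ring U] [HopfAlgebra ℂ U] (𝒰 : Λ → Submodule ℂ U) [GradedAlgebra 𝒰]
    (j : W →ₗ[ℂ] U) (K : DualGroupAlgebra Λ →ₐc[ℂ] U) (g : Uˣ)
    (hU : IsPivotalExtension ℓ 𝒲 oneW 𝒰 j K g)
    -- the symmetric integral form `B` and the quasi R-matrix
    (B : Λ →ₗ[ℤ] Λ →ₗ[ℤ] ℤ) (hB : ∀ l m, B l m = B m l)
    (Rc : (TensorProduct ℂ U U)ˣ) (hR : IsQuasiRMatrix 𝒰 hU.graded K g B Rc)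
    -- unimodularity of `𝒰_0`
    (Υ : Ubar ℓ b K (0 : GroupG r)) (hΥ : IsTwoSidedCointegral (Ubar.counit ℓ b K) Υ)
    -- the right `G`-integral normalized by `Υ`
    (lam : ∀ α : GroupG r, Ubar ℓ b K α →ₗ[ℂ] ℂ)
    (hlam : IsRightGIntegral (Ubar.comul ℓ b K) lam) (hnorm : lam 0 Υ = 1)
    -- non-degeneracy of the twist
    (htheta : lam 0 (theta0 ℓ b K g B Rc) * lam 0 (Ring.inverse (theta0 ℓ b K g B Rc)) = 1) :
    IsDistinguished (Ubar.comul ℓ b K) (Ubar.counit ℓ b K) lam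
        (fun α => Ubar.proj ℓ b K α (g : U) ^ 2) ∧
      ∀ γ : ∀ α : GroupG r, Ubar ℓ b K α,
        IsDistinguished (Ubar.comul ℓ b K) (Ubar.counit ℓ b K) lam γ →
          ∀ α, γ α = Ubar.proj ℓ b K α (g : U) ^ 2 := by
  have : Module.Free ℤ Λ := Module.Free.of_basis b
  have : IsAddTorsionFree Λ :=
    Function.Injective.isAddTorsionFree b.repr.toLinearMap.toAddMonoidHom b.repr.injective
  have hg := hU.pivot
  have hK := hU.Kel_mem
  have hKc : ∀ a, ∀ x ∈ 𝒰 0, Commute (Kel K a) x := fun a x hx => hU.commute_Kel a hx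
  have hT := hR.mem_totalDegree b hK
  have hπ := Ubar.isQuotientFamily (ℓ := ℓ) (b := b) hU.bijective.2
  obtain ⟨Y, rfl, hY⟩ := exists_isCointegralLift hΥ hnorm
  obtain ⟨t, ht, htheta'⟩ := exists_lift_theta0 (ℓ := ℓ) (b := b) hU.graded hg hK B hT
  -- the contraction of the coproduct with the right integral
  have hδ : ∀ (α β : GroupG r) (x : Ubar ℓ b K (α + β)),
      TensorProduct.rid ℂ _ ((lam β).lTensor _ (Ubar.comul ℓ b K α β x)) =
        lam (α + β) x • Ubar.proj ℓ b K α (g : U) ^ 2 := fun α β x => by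
    obtain ⟨x, rfl⟩ := Ubar.proj_surjective (α + β) x
    rw [Ubar.comul_proj, rid_lTensor_map]
    refine slice_comm_comul_eq_pivot_sq hπ (isIntegralLift hlam) hg hY
      (fun α x hx l => Ubar.proj_proj_eq_zero hK α hx l) ht ?_ hR hK hKc hT α β x
    rw [LinearMap.comp_apply, AlgHom.toLinearMap_apply, htheta']
    -- The integral of θ_0 is nonzero, so its degree 0 lift is a witness that λ_0 is nonzero on
    -- degree 0.
    exact left_ne_zero_of_mul_eq_one htheta
  have hmul : ∀ {γ : ∀ α : GroupG r, Ubar ℓ b K α},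
      IsGGrouplike (Ubar.comul ℓ b K) (Ubar.counit ℓ b K) γ → ∀ α β (x : Ubar ℓ b K (α + β)),
      γ α * TensorProduct.rid ℂ _
        ((lam β ∘ₗ LinearMap.mulLeft ℂ (γ β)).lTensor _ (Ubar.comul ℓ b K α β x)) =
      lam (α + β) (γ (α + β) * x) • Ubar.proj ℓ b K α (g : U) ^ 2 := fun {γ} hγ α β x => by
    rw [mul_rid_lTensor, ← hγ.comul_eq, ← map_mul, hδ]
  refine ⟨⟨isGGrouplike_proj_pow hg.grouplike 2, fun α β x => ?_⟩, fun γ hγ α => ?_⟩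
  · have hu : IsUnit (Ubar.proj ℓ b K α (g : U) ^ 2) := (g.isUnit.map _).pow 2
    refine hu.mul_left_cancel ((hmul (isGGrouplike_proj_pow hg.grouplike 2) α β x).trans ?_)
    rw [mul_smul_comm, mul_one]
    rfl
  · have h := hmul hγ.grouplike α (-α) (Ubar.proj ℓ b K _ Y)
    -- Stated for any β = 0 because the index at hand is α + (-α), which is only propositionally 0.
    have h1 : ∀ β : GroupG r, β = 0 → lam β (γ β * Ubar.proj ℓ b K β Y) = 1 := by
      rintro _ rfl
      rw [hΥ.left, hγ.grouplike.counit_eq, one_smul, hnorm]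
    rw [hγ.left_integral, LinearMap.comp_apply, LinearMap.mulLeft_apply,
      h1 _ (add_neg_cancel α), one_smul, one_smul, mul_one] at h
    exact h
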